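/- **Setting.** A school matching instance $I=(A,B,\succ,q)$ consists of finite sets $A$ (students) and $B$ (schools), a strict linear order $\succ_a$ on $B\cup\{\emptyset\}$ for each $a\in A$, a strict linear order $\succ_b$ on $A\cup\{\emptyset\}$ for each $b\in B$ ($\emptyset$ is the outside option), and quotas $0\le q_b\le |A|$. A matching $M$ pairs every student with exactly one element $M(a)\in B\cup\{\emptyset\}$, and every school $b$ with a set $M(b)$ that consists of either exactly $q_b$ students, or at most $q_b-1$ students together with $\emptyset$; it is identified with its set of pairs. $M$ is stable if there are no $a\in A,b\in B$ with $b\succ_a M(a)$ and $a\succ_b x$ for some $x\in M(b)$, no student with $\emptyset\succ_a M(a)$, and no school with $\emptyset\succ_b x$ for some $x\in M(b)$. Let $\mathcal S(I)$ be the set of stable matchings, ordered by $M\ge M'$ iff $M(a)\succeq_a M'(a)$ for all $a\in A$; this is a lattice, with join $\vee$, meet $\wedge$ and largest element $M_0$. $M'$ is an immediate predecessor of $M$ if $M'<M$ and no stable matching lies strictly between; then $\rho(M,M')=(M\setminus M',M'\setminus M)$ is a rotation, said to be exposed in $M$. $\mathcal R(I)$ is the set of rotations. For $M\in\mathcal S(I)$,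 let $R_M$ be the set of rotations $\rho(M_{i-1},M_i)$ along a sequence $M_0,M_1,\dots,M_k=M$ in which each $M_i$ is an immediate predecessor of $M_{i-1}$ ($R_M$ does not depend on the sequence). Put $\rho\trianglerighteq\rho'$ iff $\rho=\rho'$ or $\rho\in R_M$ for every $M$ in which $\rho'$ is exposed. A set $R$ of rotations is upper-closed if $\rho\in R$ and $\rho'\trianglerighteq\rho$ imply $\rho'\in R$; the map $M\mapsto R_M$ is a bijection from $\mathcal S(I)$ onto the upper-closed sets, with inverse $R\mapsto M_R$. Let $\mathcal F\subseteq\mathcal S(I)$ be nonempty and $f:\mathcal F\to\mathbb R$. The problem $\min_{M\in\mathcal F}f(M)$ is *minimum cut representable* if there are a digraph with vertex set $\mathcal R(I)\cup\{s,t\}$ and non-negative, possibly infinite, arc capacities (a *witness digraph*) and $C\in\mathbb R$ such that for every $R\subseteq\mathcal R(I)$: the $s$-$t$ cut $\{s\}\cup R$ has finite capacity if and only if $R$ is upper-closed and $M_R\in\mathcal F$; and in that case its capacity is $f(M_R)+C$. Let $\rho\sim\rho'$ iff for every $M\in\mathcal F$ either both or none of $\rho,\rho'$ lie in $R_M$.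 The equivalence classes are the meta-rotations; those different from $\theta_0^{\mathcal F}=\bigcap_{M\in\mathcal F}R_M$ and $\theta_z^{\mathcal F}=\mathcal R(I)\setminus\bigcup_{M\in\mathcal F}R_M$ are *proper* (each of $\theta_0^{\mathcal F}$, $\theta_z^{\mathcal F}$ may be empty). On the set $\mathcal R^{\mathcal F}_{\sf prop}(I)$ of proper meta-rotations put $\theta\trianglerighteq^{\mathcal F}\theta'$ iff for all $M\in\mathcal F$, $\theta'\subseteq R_M$ implies $\theta\subseteq R_M$. For $M\in\mathcal F$ let $\Theta_M=\{\theta\in\mathcal R^{\mathcal F}_{\sf prop}(I):\theta\subseteq R_M\}$. When $\mathcal F$ is a sublattice of $\mathcal S(I)$, let $M_0^{\mathcal F}$ be its largest element, and let $M^\theta$ (resp. $M_\theta$) be the element of $\mathcal F$ whose set of rotations is the union of $\theta_0^{\mathcal F}$ and all $\theta'\trianglerighteq^{\mathcal F}\theta$ (resp. all $\theta'\trianglerighteq^{\mathcal F}\theta$ with $\theta'\ne\theta$), and put $$\partial f_\theta=f(M^\theta)-f(M_\theta),$$ $$\partial^2 f_{\theta,\theta'}=f(M^\theta\wedge M_{\theta'})+f(M_\theta\wedge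 M^{\theta'})-f(M_\theta\wedge M_{\theta'})-f(M^\theta\wedge M^{\theta'})\quad(\theta\ne\theta').$$ *Cut digraph.* Choose a representative rotation $\widehat\theta\in\theta$ of every meta-rotation $\theta$, and a constant $\gamma\ge0$ such that $c_\theta:=\partial f_\theta-\frac12\sum_{\theta'\in\mathcal R^{\mathcal F}_{\sf prop}(I)\setminus\{\theta\}}\partial^2f_{\theta,\theta'}+\gamma\ge0$ for every proper $\theta$. The cut digraph $\mathcal D^{f,\mathcal F}$ has vertex set $\mathcal R(I)\cup\{s,t\}$ and these arcs: arcs of infinite capacity, in both directions, between any two distinct rotations of the same meta-rotation; for proper $\theta\ne\theta'$, an arc of capacity $\frac12\partial^2f_{\theta,\theta'}$ from $\widehat\theta$ to $\widehat{\theta'}$, and additionally one of infinite capacity if $\theta'\trianglerighteq^{\mathcal F}\theta$; an arc of infinite capacity from $s$ to $\widehat{\theta_0^{\mathcal F}}$ if $\theta_0^{\mathcal F}\neq\varnothing$, and one from $\widehat{\theta_z^{\mathcal F}}$ to $t$ if $\theta_z^{\mathcal F}\ne\varnothing$; and for every proper $\theta$ an arc of capacity $c_\theta$ from $\widehat\theta$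 to $t$ and an arc of capacity $\gamma$ from $s$ to $\widehat\theta$. **Theorem.** The problem $\min_{M\in\mathcal F}f(M)$ is minimum cut representable if and only if 1. $\mathcal F$ is a sublattice of $(\mathcal S(I),\ge)$; 2. $\partial^2f_{\theta,\theta'}\ge0$ for all $\theta\neq\theta'\in\mathcal R^{\mathcal F}_{\sf prop}(I)$; and 3. for every $M\in\mathcal F$, $$f(M)=f(M_0^{\mathcal F})+\sum_{\theta\in\Theta_M}\partial f_\theta-\frac12\sum_{\theta\ne\theta'\in\Theta_M}\partial^2f_{\theta,\theta'},$$ where the last sum is over ordered pairs of distinct elements of $\Theta_M$. Moreover, when the problem is minimum cut representable, the cut digraph $\mathcal D^{f,\mathcal F}$ is a witness digraph, for every choice of the representatives and of $\gamma$ as above. -/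

import Mathlib

namespace StableMatchings

universe u v

/-- A school matching instance with students `A` and schools `B`.  In `Option A`, `Option B` the
element `none` is the outside option.  `studentPref a x y` means `x ≻_a y`, and `schoolPref b x y`
means `x ≻_b y`. -/
structure SchoolInstance (A : Type u) (B : Type v) [Fintype A] where
  studentPref : A → Option B → Option B → Prop
  schoolPref : B → Option A → Option A → Prop
  studentPref_strict : ∀ a, IsStrictTotalOrder (Option B) (studentPref a)
  schoolPref_strict : ∀ b, IsStrictTotalOrder (Option A) (schoolPref b)
  quota : B → ℕ
  quota_le : ∀ b, quota b ≤ Fintype.card A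

section

variable {A : Type u} {B : Type v} [Fintype A] [Fintype B]

/-- A matching, given by the partner `M(a) ∈ B ∪ {∅}` of every student; every school receives at
most its quota of students. -/
@[ext]
structure Matching (I : SchoolInstance A B) where
  assign : A → Option B
  quota_bound : ∀ b, {a | assign a = some b}.ncard ≤ I.quota b

variable {I : SchoolInstance A B}

/-- The partners `M(b) ⊆ A ∪ {∅}` of a school: its students, and the outside option exactly when
fewer than `q_b` students are assigned to it. -/
def Matching.partners (M : Matching I) (b : B) : Set (Option A) :=
  {x | (∃ a, x = some a ∧ M.assign a = some b) ∨
    (x = none ∧ {a | M.assign a = some b}.ncard < I.quota b)}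

/-- The matching as a set of pairs in `(A ∪ {∅}) × (B ∪ {∅})`. -/
def Matching.pairs (M : Matching I) : Set (Option A × Option B) :=
  {p | (∃ a, p = (some a, M.assign a)) ∨ (∃ b x, x ∈ M.partners b ∧ p = (x, some b))}

/-- `ab` is a blocking pair of `M`. -/
def Matching.BlockingPair (M : Matching I) (a : A) (b : B) : Prop :=
  I.studentPref a (some b) (M.assign a) ∧ ∃ x ∈ M.partners b, I.schoolPref b (some a) x

/-- The student `a` prefers the outside option to the assigned school. -/
def Matching.BlockingStudent (M : Matching I) (a : A) : Prop :=
  I.studentPref a none (M.assign a)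

/-- The school `b` prefers the outside option to one of the assigned students. -/
def Matching.BlockingSchool (M : Matching I) (b : B) : Prop :=
  ∃ x ∈ M.partners b, I.schoolPref b none x

/-- A stable matching: no blocking pairs and no blocking agents. -/
@[ext]
structure StableMatching (I : SchoolInstance A B) extends Matching I where
  no_blocking_pair : ∀ a b, ¬ toMatching.BlockingPair a b
  no_blocking_student : ∀ a, ¬ toMatching.BlockingStudent a
  no_blocking_school : ∀ b, ¬ toMatching.BlockingSchool b

/-- `M' ≤ M` if and only if `M(a) ⪰_a M'(a)` for every student `a`. -/
instance : PartialOrder (StableMatching I) where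
  le M' M := ∀ a, M.assign a = M'.assign a ∨ I.studentPref a (M.assign a) (M'.assign a)
  le_refl _ _ := Or.inl rfl
  le_trans M₁ M₂ M₃ h₁ h₂ a := by
    have := I.studentPref_strict a
    rcases h₁ a with h | h <;> rcases h₂ a with h' | h'
    · exact Or.inl (h'.trans h)
    · exact Or.inr (h ▸ h')
    · exact Or.inr (h' ▸ h)
    · exact Or.inr (_root_.trans h' h)
  le_antisymm M₁ M₂ h₁ h₂ := by
    have key : M₁.assign = M₂.assign := by
      funext a
      have := I.studentPref_strict a
      rcases h₁ a with h | h
      · exact h.symm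
      rcases h₂ a with h' | h'
      · exact h'
      exact absurd h (asymm h')
    exact StableMatching.ext key

/-- The pair `(M \ M', M' \ M)`. -/
def rotationPair (M M' : StableMatching I) :
    Set (Option A × Option B) × Set (Option A × Option B) :=
  (M.pairs \ M'.pairs, M'.pairs \ M.pairs)

/-- The rotations: the pairs `ρ(M, M') = (M \ M', M' \ M)` with `M'` an immediate predecessor of
`M`, that is, with `M' < M` and nothing strictly in between. -/
@[ext]
structure Rotation (I : SchoolInstance A B) where
  val : Set (Option A × Option B) × Set (Option A × Option B)
  exists_covBy : ∃ M M' : StableMatching I, M' ⋖ M ∧ val = rotationPair M M'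

/-- The rotation `ρ(M, M')`. -/
def rotation (M M' : StableMatching I) (h : M' ⋖ M) : Rotation I :=
  ⟨rotationPair M M', M, M', h, rfl⟩

/-- `M = M_0 / R`: there is a sequence `M_0, …, M_k = M`, starting at the student-optimal stable
matching, each term an immediate predecessor of the preceding one, whose set of rotations is
`R`. -/
inductive IsElimination : Set (Rotation I) → StableMatching I → Prop
  | top (M₀ : StableMatching I) (h : IsTop M₀) : IsElimination ∅ M₀
  | step (R : Set (Rotation I)) (M M' : StableMatching I) (hR : IsElimination R M)
      (h : M' ⋖ M) : IsElimination (insert (rotation M M' h) R) M'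

/-- The set `R_M` of the rotations eliminated on the way from `M_0` to `M`.  The set `R` with
`M = M_0 / R` is the same for all sequences. -/
def rotationSet (M : StableMatching I) : Set (Rotation I) :=
  {ρ | ∃ R, IsElimination R M ∧ ρ ∈ R}

/-- `ρ` is exposed in `M`. -/
def Exposed (ρ : Rotation I) (M : StableMatching I) : Prop :=
  ∃ (M' : StableMatching I) (h : M' ⋖ M), ρ = rotation M M' h

/-- `ρ ⊵ ρ'` in the poset of rotations. -/
def Rotation.Above (ρ ρ' : Rotation I) : Prop :=
  ρ = ρ' ∨ ∀ M : StableMatching I, Exposed ρ' M → ρ ∈ rotationSet M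

/-- `R` is an upper-closed subset of the poset of rotations. -/
def UpperClosed (R : Set (Rotation I)) : Prop :=
  ∀ ρ ∈ R, ∀ ρ' : Rotation I, ρ'.Above ρ → ρ' ∈ R

/-- `F` is a sublattice of the lattice of stable matchings: it contains the join and the meet,
taken among all stable matchings, of any two of its elements. -/
def IsStableSublattice (F : Set (StableMatching I)) : Prop :=
  ∀ M ∈ F, ∀ M' ∈ F,
    (∃ J ∈ F, IsLUB ({M, M'} : Set (StableMatching I)) J) ∧
    (∃ K ∈ F, IsGLB ({M, M'} : Set (StableMatching I)) K)

/-! ### Meta-rotations -/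

/-- `ρ ∼ ρ'`: the two rotations are eliminated together in every matching of `F`. -/
def MetaEquiv (F : Set (StableMatching I)) (ρ ρ' : Rotation I) : Prop :=
  ∀ M ∈ F, ρ ∈ rotationSet M ↔ ρ' ∈ rotationSet M

/-- The rotations eliminated in every matching of `F`. -/
def initialMeta (F : Set (StableMatching I)) : Set (Rotation I) :=
  {ρ | ∀ M ∈ F, ρ ∈ rotationSet M}

/-- The rotations eliminated in no matching of `F`. -/
def finalMeta (F : Set (StableMatching I)) : Set (Rotation I) :=
  {ρ | ∀ M ∈ F, ρ ∉ rotationSet M}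

/-- The (nonempty) meta-rotations of `F`: the equivalence classes of `∼`. -/
@[ext]
structure MetaRotation (F : Set (StableMatching I)) where
  carrier : Set (Rotation I)
  isClass : ∃ ρ, carrier = {ρ' | MetaEquiv F ρ ρ'}

/-- The proper meta-rotations: those different from the two trivial ones. -/
@[ext]
structure ProperMetaRotation (F : Set (StableMatching I)) extends MetaRotation F where
  ne_initial : carrier ≠ initialMeta F
  ne_final : carrier ≠ finalMeta F

instance : Finite (Rotation I) :=
  Finite.of_injective Rotation.val fun _ _ h => Rotation.ext h

instance (F : Set (StableMatching I)) : Finite (MetaRotation F) :=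
  Finite.of_injective MetaRotation.carrier fun _ _ h => MetaRotation.ext h

instance (F : Set (StableMatching I)) : Finite (ProperMetaRotation F) :=
  Finite.of_injective (fun θ => θ.carrier) fun _ _ h => ProperMetaRotation.ext h

noncomputable instance (F : Set (StableMatching I)) : Fintype (MetaRotation F) :=
  Fintype.ofFinite _

noncomputable instance (F : Set (StableMatching I)) : Fintype (ProperMetaRotation F) :=
  Fintype.ofFinite _

variable {F : Set (StableMatching I)}

/-- `θ ⊵ θ'` in the poset of proper meta-rotations. -/
def ProperMetaRotation.Above (θ θ' : ProperMetaRotation F) : Prop :=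
  ∀ M ∈ F, θ'.carrier ⊆ rotationSet M → θ.carrier ⊆ rotationSet M

/-- The proper meta-rotations `Θ_M` into which `R_M` without the initial meta-rotation is
partitioned. -/
def metaSet (M : F) : Set (ProperMetaRotation F) :=
  {θ | θ.carrier ⊆ rotationSet M.1}

/-- The matching `M_Θ ∈ F` of an upper-closed set `Θ` of proper meta-rotations: the one whose set
of rotations is the union of the initial meta-rotation and of the members of `Θ`.  (It exists and
is unique when `F` is a nonempty sublattice.) -/
noncomputable def matchingOf [Nonempty F] (Θ : Set (ProperMetaRotation F)) : F :=
  Classical.epsilon fun M : F => rotationSet M.1 = initialMeta F ∪ ⋃ θ ∈ Θ, θ.carrier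

/-- `M^θ`, the matching of the set of all `θ' ⊵ θ`. -/
noncomputable def matchingUpper [Nonempty F] (θ : ProperMetaRotation F) : F :=
  matchingOf {θ' | θ'.Above θ}

/-- `M_θ`, the matching of the set of all `θ' ⊵ θ` different from `θ`. -/
noncomputable def matchingLower [Nonempty F] (θ : ProperMetaRotation F) : F :=
  matchingOf {θ' | θ'.Above θ ∧ θ' ≠ θ}

/-- The meet `M ∧ M'` in the lattice of stable matchings (which lies in `F` when `F` is a
sublattice). -/
noncomputable def meet [Nonempty F] (M M' : F) : F :=
  Classical.epsilon fun K : F => IsGLB ({M.1, M'.1} : Set (StableMatching I)) K.1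

/-- The largest element `M_0^F` of `F`. -/
noncomputable def largest (F : Set (StableMatching I)) [Nonempty F] : F :=
  Classical.epsilon fun M : F => IsGreatest F M.1

/-- The first order differential `∂f_θ`. -/
noncomputable def diff1 [Nonempty F] (f : F → ℝ) (θ : ProperMetaRotation F) : ℝ :=
  f (matchingUpper θ) - f (matchingLower θ)

/-- The second order differential `∂²f_{θ,θ'}` (used for `θ ≠ θ'` only). -/
noncomputable def diff2 [Nonempty F] (f : F → ℝ) (θ θ' : ProperMetaRotation F) : ℝ :=
  f (meet (matchingUpper θ) (matchingLower θ')) + f (meet (matchingLower θ) (matchingUpper θ'))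
    - f (meet (matchingLower θ) (matchingLower θ')) - f (meet (matchingUpper θ) (matchingUpper θ'))

open Classical in
/-- The second order expansion of `f`; the double sum is over ordered pairs of distinct elements
of `Θ_M`. -/
noncomputable def secondOrderExpansion [Nonempty F] (f : F → ℝ) (M : F) : ℝ :=
  f (largest F) + (∑ θ : ProperMetaRotation F, if θ ∈ metaSet M then diff1 f θ else 0)
    - (1 / 2) * ∑ θ : ProperMetaRotation F, ∑ θ' : ProperMetaRotation F,
        if θ ∈ metaSet M ∧ θ' ∈ metaSet M ∧ θ ≠ θ' then diff2 f θ θ' else 0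

/-! ### Cuts -/

/-- The vertices: a source, a sink and the rotations. -/
inductive Vertex (I : SchoolInstance A B) where
  | source : Vertex I
  | sink : Vertex I
  | rot (ρ : Rotation I) : Vertex I

instance : Finite (Vertex I) :=
  Finite.of_surjective
    (fun x : Option (Option (Rotation I)) => match x with
      | none => Vertex.source
      | some none => Vertex.sink
      | some (some ρ) => Vertex.rot ρ)
    (fun v => match v with
      | Vertex.source => ⟨none, rfl⟩
      | Vertex.sink => ⟨some none, rfl⟩
      | Vertex.rot ρ => ⟨some (some ρ), rfl⟩)

noncomputable instance : Fintype (Vertex I) := Fintype.ofFinite _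

/-- A digraph on the rotations, the source and the sink, with extended real arc capacities: the
value at `(u, v)` is the total capacity of the arcs from `u` to `v`, and `0` if there is none. -/
abbrev CapDigraph (I : SchoolInstance A B) := Vertex I → Vertex I → EReal

/-- The vertex set `{s} ∪ R`. -/
def cutSide (R : Set (Rotation I)) : Set (Vertex I) :=
  {Vertex.source} ∪ Vertex.rot '' R

open Classical in
/-- The capacity of the `s`-`t` cut `{s} ∪ R`. -/
noncomputable def cutCapacity (D : CapDigraph I) (R : Set (Rotation I)) : EReal :=
  ∑ x : Vertex I, ∑ y : Vertex I, if x ∈ cutSide R ∧ y ∉ cutSide R then D x y else 0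

/-- `D` is a witness digraph of the problem of minimizing `f` over `F`. -/
def IsWitness (f : F → ℝ) (D : CapDigraph I) : Prop :=
  (∀ x y, 0 ≤ D x y) ∧ ∃ C : ℝ,
    (∀ R : Set (Rotation I),
      cutCapacity D R < ⊤ ↔ UpperClosed R ∧ ∃ M : F, rotationSet M.1 = R) ∧
    (∀ R : Set (Rotation I), cutCapacity D R < ⊤ →
      ∀ M : F, rotationSet M.1 = R → cutCapacity D R = ((f M + C : ℝ) : EReal))

/-- The problem of minimizing `f` over `F` is minimum cut representable. -/
def MinCutRepresentable (f : F → ℝ) : Prop :=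
  ∃ D : CapDigraph I, IsWitness f D

open Classical in
/-- The capacity, in the cut digraph, of the arc from the representative of `θ` to the sink. -/
noncomputable def sinkCapacity [Nonempty F] (f : F → ℝ) (γ : ℝ) (θ : ProperMetaRotation F) : ℝ :=
  diff1 f θ - (1 / 2) * (∑ θ' : ProperMetaRotation F, if θ' ≠ θ then diff2 f θ θ' else 0) + γ

/-- The requirement on the constant `γ` of the cut digraph. -/
def IsAdmissible [Nonempty F] (f : F → ℝ) (γ : ℝ) : Prop :=
  0 ≤ γ ∧ ∀ θ : ProperMetaRotation F, 0 ≤ sinkCapacity f γ θ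

open Classical in
/-- The cut digraph of `(f, F)`, for a choice `rep` of representatives of the meta-rotations and a
constant `γ`.  Parallel arcs are merged by adding their capacities. -/
noncomputable def cutDigraph [Nonempty F] (f : F → ℝ) (rep : MetaRotation F → Rotation I)
    (γ : ℝ) : CapDigraph I
  | .rot ρ, .rot ρ' =>
      (if ρ ≠ ρ' ∧ ∃ θ : MetaRotation F, ρ ∈ θ.carrier ∧ ρ' ∈ θ.carrier then ⊤ else 0) +
      ∑ θ : ProperMetaRotation F, ∑ θ' : ProperMetaRotation F,
        if θ ≠ θ' ∧ ρ = rep θ.toMetaRotation ∧ ρ' = rep θ'.toMetaRotation then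
          (if θ'.Above θ then ⊤ else 0) + (((1 / 2) * diff2 f θ θ' : ℝ) : EReal)
        else 0
  | .source, .rot ρ =>
      (if ∃ θ : MetaRotation F, θ.carrier = initialMeta F ∧ ρ = rep θ then ⊤ else 0) +
      ∑ θ : ProperMetaRotation F, if ρ = rep θ.toMetaRotation then (γ : EReal) else 0
  | .rot ρ, .sink =>
      (if ∃ θ : MetaRotation F, θ.carrier = finalMeta F ∧ ρ = rep θ then ⊤ else 0) +
      ∑ θ : ProperMetaRotation F,
        if ρ = rep θ.toMetaRotation then (sinkCapacity f γ θ : EReal) else 0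
  | _, _ => 0

end

end StableMatchings

set_option linter.unusedSectionVars false

/-! Everything is reduced to functions on the lower sets of a finite poset. Stable matchings form a
lattice in which every student takes the better (or worse) of two partners. The proof compares two
matchings school by school: a local inequality, summed over the schools, is matched by a global
count, so it is an equality everywhere and each school is polarized (`gainers_losers_empty_or`). A
rotation then acts as a threshold: it lies in `rotationSet M` iff the rank of one fixed student's
partner is at most a constant (`exists_mem_rotationSet_iff`). Hence joins and meets of matchings are
intersections and unions of rotation sets, and for a sublattice `F` the members correspond to the
lower sets of proper meta-rotations (`IsStableSublattice.exists_metaSet_eq`). Necessity: a cut is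
finite iff no infinite arc leaves it, and this survives intersections and unions of cut sides, so
`F` is a sublattice. For disjoint `S`, `X`, `Y`, the mixed difference of a cut function in the
directions `X`, `Y` is the total capacity of the arcs between `X` and `Y`, which is nonnegative and
independent of `S` (`realCut_mixedDiff`). A function with such constant mixed differences equals its
second order expansion (`HasMixedDiff.expansion`). Sufficiency, and the last assertion: in the cut
digraph the infinite arcs allow exactly the rotation sets of members of `F`
(`cutCapacity_cutDigraph_lt_top_iff`), and the finite arcs add up to the second order expansion plus
a constant (`realCut_finiteCapacity`). -/

namespace StableMatchings

/-! ### The lattice of stable matchings, by counting at each school. -/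

section Lattice

variable {A : Type*} {B : Type*} [Fintype A] [Fintype B] {I : SchoolInstance A B}

open Classical in
/-- The number of alternatives to which the student `a` prefers `x`. -/
noncomputable def SchoolInstance.rank (I : SchoolInstance A B) (a : A) (x : Option B) : ℕ :=
  (Finset.univ.filter fun y => I.studentPref a x y).card

theorem rank_lt_of_studentPref {a : A} {x y : Option B} (h : I.studentPref a x y) :
    I.rank a y < I.rank a x := by
  classical
  have := I.studentPref_strict a
  refine Finset.card_lt_card (Finset.ssubset_iff_subset_ne.2 ⟨fun z hz => ?_, fun he => ?_⟩)
  · simp only [Finset.mem_filter, Finset.mem_univ, true_and] at hz ⊢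
    exact _root_.trans h hz
  · have hy : y ∈ Finset.univ.filter fun z => I.studentPref a x z := by simpa using h
    rw [← he] at hy
    exact irrefl y (by simpa using hy)

theorem studentPref_trichotomy (I : SchoolInstance A B) (a : A) (x y : Option B) :
    I.studentPref a x y ∨ x = y ∨ I.studentPref a y x := by
  have := I.studentPref_strict a
  exact trichotomous_of (I.studentPref a) x y

theorem schoolPref_trichotomy (I : SchoolInstance A B) (b : B) (x y : Option A) :
    I.schoolPref b x y ∨ x = y ∨ I.schoolPref b y x := by
  have := I.schoolPref_strict b
  exact trichotomous_of (I.schoolPref b) x y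

theorem rank_lt_iff {a : A} {x y : Option B} :
    I.rank a y < I.rank a x ↔ I.studentPref a x y := by
  refine ⟨fun h => ?_, rank_lt_of_studentPref⟩
  rcases studentPref_trichotomy I a x y with h' | h' | h'
  · exact h'
  · subst h'; omega
  · have := rank_lt_of_studentPref h'; omega

theorem rank_injective (I : SchoolInstance A B) (a : A) : Function.Injective (I.rank a) := by
  intro x y h
  rcases studentPref_trichotomy I a x y with h' | h' | h'
  · have := rank_lt_of_studentPref h'; omega
  · exact h'
  · have := rank_lt_of_studentPref h'; omega

/-- The rank, for the student `a`, of the partner of `a`. -/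
noncomputable def StableMatching.rk (M : StableMatching I) (a : A) : ℕ :=
  I.rank a (M.assign a)

theorem StableMatching.rk_eq_iff {M N : StableMatching I} {a : A} :
    M.rk a = N.rk a ↔ M.assign a = N.assign a :=
  (rank_injective I a).eq_iff

theorem StableMatching.le_iff_rk {M N : StableMatching I} : M ≤ N ↔ ∀ a, M.rk a ≤ N.rk a := by
  refine forall_congr' fun a => ?_
  rw [le_iff_eq_or_lt, rk_eq_iff, eq_comm]
  exact or_congr Iff.rfl rank_lt_iff.symm

theorem StableMatching.ext_assign {M N : StableMatching I}
    (h : ∀ a, M.assign a = N.assign a) : M = N :=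
  StableMatching.ext (funext h)

namespace StableMatching

open Classical in
/-- The students of the school `b`. -/
noncomputable def students (M : StableMatching I) (b : B) : Finset A :=
  Finset.univ.filter fun a => M.assign a = some b

theorem mem_students {M : StableMatching I} {b : B} {a : A} :
    a ∈ M.students b ↔ M.assign a = some b := by
  simp [students]

theorem ncard_students (M : StableMatching I) (b : B) :
    {a | M.assign a = some b}.ncard = (M.students b).card := by
  classical
  rw [← Set.ncard_coe_finset]
  congr 1
  ext a
  simp [mem_students]

theorem card_students_le (M : StableMatching I) (b : B) : (M.students b).card ≤ I.quota b := by
  rw [← ncard_students]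
  exact M.quota_bound b

theorem some_mem_partners {M : StableMatching I} {b : B} {a : A} :
    some a ∈ M.partners b ↔ M.assign a = some b := by
  simp [Matching.partners]

theorem none_mem_partners {M : StableMatching I} {b : B} :
    none ∈ M.partners b ↔ (M.students b).card < I.quota b := by
  simp [Matching.partners, ncard_students]

theorem not_schoolPref_none {M : StableMatching I} {b : B} {x : Option A}
    (hx : x ∈ M.partners b) : ¬ I.schoolPref b none x :=
  fun h => M.no_blocking_school b ⟨x, hx, h⟩

theorem rank_none_le (M : StableMatching I) (a : A) : I.rank a none ≤ M.rk a := by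
  by_contra h
  exact M.no_blocking_student a (rank_lt_iff.1 (not_le.1 h))

/-- If a student prefers the school `b` to the own partner, the school prefers all its partners. -/
theorem schoolPref_of_rk_lt {M : StableMatching I} {a : A} {b : B}
    (h : M.rk a < I.rank a (some b)) {x : Option A} (hx : x ∈ M.partners b) :
    I.schoolPref b x (some a) := by
  rcases schoolPref_trichotomy I b x (some a) with h' | h' | h'
  · exact h'
  · subst h'
    rw [some_mem_partners] at hx
    rw [← hx] at h
    exact absurd h (lt_irrefl _)
  · exact absurd ⟨rank_lt_iff.1 h, x, hx, h'⟩ (M.no_blocking_pair a b)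

open Classical in
/-- The students of `b` in `M` who prefer their partner in `M`. -/
noncomputable def gainers (M N : StableMatching I) (b : B) : Finset A :=
  (M.students b).filter fun a => N.rk a < M.rk a

open Classical in
/-- The students of `b` in `M` who prefer their partner in `N`. -/
noncomputable def losers (M N : StableMatching I) (b : B) : Finset A :=
  (M.students b).filter fun a => M.rk a < N.rk a

open Classical in
/-- The students who have the same partner in both matchings. -/
noncomputable def keepers (M N : StableMatching I) (b : B) : Finset A :=
  (M.students b).filter fun a => M.rk a = N.rk a

theorem mem_gainers {M N : StableMatching I} {b : B} {a : A} :
    a ∈ gainers M N b ↔ M.assign a = some b ∧ N.rk a < M.rk a := by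
  simp [gainers, mem_students]

theorem mem_losers {M N : StableMatching I} {b : B} {a : A} :
    a ∈ losers M N b ↔ M.assign a = some b ∧ M.rk a < N.rk a := by
  simp [losers, mem_students]

theorem mem_keepers {M N : StableMatching I} {b : B} {a : A} :
    a ∈ keepers M N b ↔ M.assign a = some b ∧ M.rk a = N.rk a := by
  simp [keepers, mem_students]

theorem keepers_comm (M N : StableMatching I) (b : B) : keepers M N b = keepers N M b := by
  ext a
  simp only [mem_keepers, rk_eq_iff]
  constructor <;> rintro ⟨h, h'⟩ <;> simp_all

theorem card_students_eq (M N : StableMatching I) (b : B) :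
    (M.students b).card =
      (gainers M N b).card + (losers M N b).card + (keepers M N b).card := by
  classical
  rw [← Finset.card_union_of_disjoint, ← Finset.card_union_of_disjoint]
  · congr 1
    ext a
    simp only [Finset.mem_union, mem_gainers, mem_losers, mem_keepers, mem_students]
    have := lt_trichotomy (N.rk a) (M.rk a)
    constructor
    · intro h; rcases this with h' | h' | h'
      · simp [h, h']
      · simp [h, h']
      · simp [h, h']
    · tauto
  · rw [Finset.disjoint_left]
    intro a ha ha'
    simp only [Finset.mem_union, mem_gainers, mem_losers, mem_keepers] at ha ha'
    omega
  · rw [Finset.disjoint_left]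
    intro a ha ha'
    simp only [mem_gainers, mem_losers] at ha ha'
    omega

theorem schoolPref_of_mem_gainers {M N : StableMatching I} {b : B} {a : A}
    (ha : a ∈ gainers M N b) {x : Option A} (hx : x ∈ N.partners b) :
    I.schoolPref b x (some a) := by
  rw [mem_gainers] at ha
  refine schoolPref_of_rk_lt ?_ hx
  rw [← ha.1]
  exact ha.2

/-- A vacant seat in `N` would make the outside option a partner of `b`, which `b` would then have
to prefer to `a`, its own student in the stable matching `M`. -/
theorem card_students_of_mem_gainers {M N : StableMatching I} {b : B} {a : A}
    (ha : a ∈ gainers M N b) : (N.students b).card = I.quota b := by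
  refine le_antisymm (card_students_le N b) (not_lt.1 fun h => ?_)
  exact not_schoolPref_none (some_mem_partners.2 (mem_gainers.1 ha).1)
    (schoolPref_of_mem_gainers ha (none_mem_partners.2 h))

theorem gainers_eq_empty_or (M N : StableMatching I) (b : B) :
    gainers M N b = ∅ ∨ gainers N M b = ∅ := by
  by_contra! h
  obtain ⟨⟨x, hx⟩, ⟨y, hy⟩⟩ := h
  have := I.schoolPref_strict b
  exact asymm (schoolPref_of_mem_gainers hx (some_mem_partners.2 (mem_gainers.1 hy).1))
    (schoolPref_of_mem_gainers hy (some_mem_partners.2 (mem_gainers.1 hx).1))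

/-- A gainer forces `b` to be full in `N`, while `M` cannot exceed the quota. The keepers are common
to both sides, and `N` has no gainers, so only its losers can make up the difference. -/
theorem card_gainers_add_card_losers_le {M N : StableMatching I} {b : B}
    (h : (gainers M N b).Nonempty) :
    (gainers M N b).card + (losers M N b).card ≤ (losers N M b).card := by
  obtain ⟨a, ha⟩ := h
  have h1 := card_students_of_mem_gainers ha
  have h2 : gainers N M b = ∅ :=
    (gainers_eq_empty_or M N b).resolve_left (Finset.ne_empty_of_mem ha)
  have h3 := card_students_eq M N b
  have h4 := card_students_eq N M b
  rw [keepers_comm N M, h2, Finset.card_empty] at h4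
  have h5 := card_students_le M b
  omega

theorem card_gainers_add_le (M N : StableMatching I) (b : B) :
    (gainers M N b).card + (gainers N M b).card ≤
      (losers N M b).card + (losers M N b).card := by
  rcases (gainers M N b).eq_empty_or_nonempty with h | h
  · rcases (gainers N M b).eq_empty_or_nonempty with h' | h'
    · simp [h, h']
    · have := card_gainers_add_card_losers_le h'
      rw [h, Finset.card_empty]
      omega
  · have := card_gainers_add_card_losers_le h
    have h2 := (gainers_eq_empty_or M N b).resolve_left h.ne_empty
    rw [h2, Finset.card_empty]
    omega

/-- Both sums count students strictly better off in `M`, sorted by their partner in `N` and in `M`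
respectively. Such a student is never unmatched in `M` but may be unmatched in `N`. -/
theorem sum_card_losers_le (M N : StableMatching I) :
    ∑ b, (losers N M b).card ≤ ∑ b, (gainers M N b).card := by
  classical
  have h1 := Finset.card_eq_sum_card_fiberwise (s := Finset.univ.filter fun a => N.rk a < M.rk a)
    (f := fun a => M.assign a) (t := Finset.univ) (fun _ _ => Finset.mem_coe.2 (Finset.mem_univ _))
  have h2 := Finset.card_eq_sum_card_fiberwise (s := Finset.univ.filter fun a => N.rk a < M.rk a)
    (f := fun a => N.assign a) (t := Finset.univ) (fun _ _ => Finset.mem_coe.2 (Finset.mem_univ _))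
  rw [Fintype.sum_option] at h1 h2
  have h3 : ((Finset.univ.filter fun a => N.rk a < M.rk a).filter
      fun a => M.assign a = none) = ∅ := by
    rw [Finset.filter_eq_empty_iff]
    intro a ha hn
    have h4 := rank_none_le N a
    rw [← hn] at h4
    simp only [Finset.mem_filter, Finset.mem_univ, true_and] at ha
    exact absurd ha (not_lt.2 h4)
  have h4 : ∀ b, ((Finset.univ.filter fun a => N.rk a < M.rk a).filter
      fun a => M.assign a = some b) = gainers M N b := fun b => by
    ext a; simp [mem_gainers, and_comm]
  have h5 : ∀ b, ((Finset.univ.filter fun a => N.rk a < M.rk a).filter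
      fun a => N.assign a = some b) = losers N M b := fun b => by
    ext a; simp [mem_losers, and_comm]
  rw [h3, Finset.card_empty, zero_add] at h1
  simp only [h4] at h1
  simp only [h5] at h2
  omega

/-- The schoolwise inequality and the global count point in opposite directions, so no school can
have slack. -/
theorem card_gainers_add (M N : StableMatching I) (b : B) :
    (gainers M N b).card + (gainers N M b).card =
      (losers N M b).card + (losers M N b).card := by
  refine (Finset.sum_eq_sum_iff_of_le fun b _ => card_gainers_add_le M N b).1 ?_ b
    (Finset.mem_univ b)
  refine le_antisymm (Finset.sum_le_sum fun b _ => card_gainers_add_le M N b) ?_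
  rw [Finset.sum_add_distrib, Finset.sum_add_distrib]
  exact add_le_add (sum_card_losers_le M N) (sum_card_losers_le N M)

/-- At every school, one of the two matchings is the better one for all its students. -/
theorem gainers_losers_empty_or (M N : StableMatching I) (b : B) :
    (gainers N M b = ∅ ∧ losers M N b = ∅) ∨ (gainers M N b = ∅ ∧ losers N M b = ∅) := by
  have h := card_gainers_add M N b
  rcases (gainers M N b).eq_empty_or_nonempty with h1 | h1
  · rcases (gainers N M b).eq_empty_or_nonempty with h2 | h2
    · rw [h1, h2, Finset.card_empty] at h
      left
      exact ⟨h2, Finset.card_eq_zero.1 (by omega)⟩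
    · have := card_gainers_add_card_losers_le h2
      rw [h1, Finset.card_empty] at h
      right
      exact ⟨h1, Finset.card_eq_zero.1 (by omega)⟩
  · have h2 := (gainers_eq_empty_or M N b).resolve_left h1.ne_empty
    have := card_gainers_add_card_losers_le h1
    rw [h2, Finset.card_empty] at h
    left
    exact ⟨h2, Finset.card_eq_zero.1 (by omega)⟩

/-- A rural hospitals statement: it shows that vacant seats never change, so rotations only record
moves of students. -/
theorem card_students_congr (M N : StableMatching I) (b : B) :
    (M.students b).card = (N.students b).card := by
  have h := card_gainers_add M N b
  have h1 := card_students_eq M N b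
  have h2 := card_students_eq N M b
  rw [keepers_comm N M] at h2
  rcases gainers_losers_empty_or M N b with ⟨h3, h4⟩ | ⟨h3, h4⟩ <;>
  · simp only [h3, h4, Finset.card_empty] at h h1 h2
    omega

theorem partners_congr {M N : StableMatching I} {b : B}
    (h : ∀ a, M.assign a = some b ↔ N.assign a = some b) : M.partners b = N.partners b := by
  simp only [Matching.partners, h]

/-- A matching whose sets of students are all sets of students of `M` or `N`, and which has no
blocking pair, is stable. -/
theorem exists_stable_of_assign (M N : StableMatching I) (g : A → Option B)
    (hg : ∀ a, g a = M.assign a ∨ g a = N.assign a)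
    (hb : ∀ b, (∀ a, g a = some b ↔ M.assign a = some b) ∨
      (∀ a, g a = some b ↔ N.assign a = some b))
    (hpair : ∀ a b x, I.rank a (g a) < I.rank a (some b) →
      ((∀ a, g a = some b ↔ M.assign a = some b) → x ∈ M.partners b →
        I.schoolPref b (some a) x → False) ∧
      ((∀ a, g a = some b ↔ N.assign a = some b) → x ∈ N.partners b →
        I.schoolPref b (some a) x → False)) :
    ∃ J : StableMatching I, ∀ a, J.assign a = g a := by
  have hq : ∀ b, {a | g a = some b}.ncard ≤ I.quota b := by
    intro b
    rcases hb b with h | h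
    · simp only [h]; exact M.quota_bound b
    · simp only [h]; exact N.quota_bound b
  have hp : ∀ b, ((∀ a, g a = some b ↔ M.assign a = some b) ∧
      (Matching.mk (I := I) g hq).partners b = M.partners b) ∨
      ((∀ a, g a = some b ↔ N.assign a = some b) ∧
      (Matching.mk (I := I) g hq).partners b = N.partners b) := by
    intro b
    rcases hb b with h | h
    · left; refine ⟨h, ?_⟩; simp only [Matching.partners, h]
    · right; refine ⟨h, ?_⟩; simp only [Matching.partners, h]
  refine ⟨⟨⟨g, hq⟩, ?_, ?_, ?_⟩, fun a => rfl⟩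
  · rintro a b ⟨h, x, hx, hax⟩
    have h := hpair a b x (rank_lt_iff.2 h)
    rcases hp b with h' | h'
    · exact h.1 h'.1 (h'.2 ▸ hx) hax
    · exact h.2 h'.1 (h'.2 ▸ hx) hax
  · intro a h
    unfold Matching.BlockingStudent at h
    rcases hg a with h' | h'
    · simp only [h'] at h; exact M.no_blocking_student a h
    · simp only [h'] at h; exact N.no_blocking_student a h
  · rintro b ⟨x, hx, h⟩
    rcases hp b with h' | h'
    · exact M.no_blocking_school b ⟨x, h'.2 ▸ hx, h⟩
    · exact N.no_blocking_school b ⟨x, h'.2 ▸ hx, h⟩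

open Classical in
/-- Every student chooses the better one of the two partners. -/
noncomputable def best (M N : StableMatching I) (a : A) : Option B :=
  if M.rk a < N.rk a then N.assign a else M.assign a

open Classical in
/-- Every student chooses the worse one of the two partners. -/
noncomputable def worst (M N : StableMatching I) (a : A) : Option B :=
  if M.rk a < N.rk a then M.assign a else N.assign a

theorem rank_best (M N : StableMatching I) (a : A) :
    I.rank a (best M N a) = max (M.rk a) (N.rk a) := by
  unfold best
  split_ifs with h
  · exact (max_eq_right h.le).symm
  · exact (max_eq_left (not_lt.1 h)).symm

theorem rank_worst (M N : StableMatching I) (a : A) :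
    I.rank a (worst M N a) = min (M.rk a) (N.rk a) := by
  unfold worst
  split_ifs with h
  · exact (min_eq_left h.le).symm
  · exact (min_eq_right (not_lt.1 h)).symm

theorem best_worst_comm (M N : StableMatching I) :
    best M N = best N M ∧ worst M N = worst N M := by
  constructor <;> funext a <;> apply rank_injective I a
  · rw [rank_best, rank_best, max_comm]
  · rw [rank_worst, rank_worst, min_comm]

theorem best_worst_eq_some_of_empty {M N : StableMatching I} {b : B}
    (h1 : gainers N M b = ∅) (h2 : losers M N b = ∅) (a : A) :
    (best M N a = some b ↔ M.assign a = some b) ∧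
      (worst M N a = some b ↔ N.assign a = some b) := by
  have h3 : ¬ (N.assign a = some b ∧ M.rk a < N.rk a) := fun h => by
    have := mem_gainers.2 h; rw [h1] at this; simp at this
  have h4 : ¬ (M.assign a = some b ∧ M.rk a < N.rk a) := fun h => by
    have := mem_losers.2 h; rw [h2] at this; simp at this
  unfold best worst
  split_ifs with h <;> tauto

theorem best_worst_eq_some (M N : StableMatching I) (b : B) :
    (∀ a, (best M N a = some b ↔ M.assign a = some b) ∧
      (worst M N a = some b ↔ N.assign a = some b)) ∨
    (∀ a, (best M N a = some b ↔ N.assign a = some b) ∧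
      (worst M N a = some b ↔ M.assign a = some b)) := by
  rcases gainers_losers_empty_or M N b with ⟨h1, h2⟩ | ⟨h1, h2⟩
  · exact Or.inl (best_worst_eq_some_of_empty h1 h2)
  · right
    rw [(best_worst_comm M N).1, (best_worst_comm M N).2]
    exact best_worst_eq_some_of_empty h1 h2

theorem exists_sup (M N : StableMatching I) :
    ∃ J : StableMatching I, ∀ a, J.rk a = max (M.rk a) (N.rk a) := by
  obtain ⟨J, hJ⟩ := exists_stable_of_assign M N (best M N)
    (fun a => by unfold best; split_ifs <;> simp)
    (fun b => by
      rcases best_worst_eq_some M N b with h | h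
      · exact Or.inl fun a => (h a).1
      · exact Or.inr fun a => (h a).1)
    (fun a b x h => by
      rw [rank_best, max_lt_iff] at h
      exact ⟨fun _ hx hax => M.no_blocking_pair a b ⟨rank_lt_iff.1 h.1, x, hx, hax⟩,
        fun _ hx hax => N.no_blocking_pair a b ⟨rank_lt_iff.1 h.2, x, hx, hax⟩⟩)
  exact ⟨J, fun a => by rw [rk, hJ, rank_best]⟩

/-- If `b` has in `N` its students of the pointwise worst matching, then no student prefers `b` to
the worse one of the partners and is preferred by `b` to a partner of `b` in `N`. -/
theorem not_schoolPref_of_worst {M N : StableMatching I} {b : B}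
    (hw : ∀ a, worst M N a = some b ↔ N.assign a = some b) {a : A}
    (ha : I.rank a (worst M N a) < I.rank a (some b)) {x : Option A} (hx : x ∈ N.partners b)
    (hax : I.schoolPref b (some a) x) : False := by
  by_cases hN : N.rk a < I.rank a (some b)
  · exact N.no_blocking_pair a b ⟨rank_lt_iff.1 hN, x, hx, hax⟩
  have hM : M.rk a < I.rank a (some b) := by
    rw [rank_worst, min_lt_iff] at ha
    exact ha.resolve_right hN
  have := I.schoolPref_strict b
  rcases (gainers M N b).eq_empty_or_nonempty with h | ⟨y, hy⟩
  -- Without gainers, every student of `b` in `M` is there in the worst matching too, hence in `N`;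
  -- equal cardinalities make the two sets of students equal, so that the pair blocks `M`.
  · have hMN : ∀ y, M.assign y = some b ↔ N.assign y = some b := by
      have hcard := card_students_congr M N b
      have hsub : M.students b ⊆ N.students b := by
        intro y hy
        rw [mem_students] at hy ⊢
        have h3 : ¬ (N.rk y < M.rk y) := fun h' => by
          have := mem_gainers.2 ⟨hy, h'⟩
          rw [h] at this
          simp at this
        rw [← hw]
        apply rank_injective I y
        rw [rank_worst, min_eq_left (not_lt.1 h3), ← hy]
        rfl
      have heq := Finset.eq_of_subset_of_card_le hsub hcard.ge
      intro y
      rw [← mem_students, ← mem_students, heq]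
    rw [← partners_congr hMN] at hx
    exact M.no_blocking_pair a b ⟨rank_lt_iff.1 hM, x, hx, hax⟩
  -- A gainer `y` yields a cycle: `b` prefers `x` to `y`, `y` to `a`, and `a` to `x`.
  · have h1 := schoolPref_of_mem_gainers hy hx
    have h2 := schoolPref_of_rk_lt hM (some_mem_partners.2 (mem_gainers.1 hy).1)
    exact asymm hax (_root_.trans h1 h2)

theorem exists_inf (M N : StableMatching I) :
    ∃ K : StableMatching I, ∀ a, K.rk a = min (M.rk a) (N.rk a) := by
  obtain ⟨K, hK⟩ := exists_stable_of_assign M N (worst M N)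
    (fun a => by unfold worst; split_ifs <;> simp)
    (fun b => by
      rcases best_worst_eq_some M N b with h | h
      · exact Or.inr fun a => (h a).2
      · exact Or.inl fun a => (h a).2)
    (fun a b x h => ⟨fun hw hx hax => by
        rw [(best_worst_comm M N).2] at h hw
        exact not_schoolPref_of_worst hw h hx hax,
      fun hw hx hax => not_schoolPref_of_worst hw h hx hax⟩)
  exact ⟨K, fun a => by rw [rk, hK, rank_worst]⟩

end StableMatching

end Lattice

end StableMatchings

namespace StableMatchings

/-! ### Rotations as rank thresholds, and the rotation sets of joins and meets. -/

section Rotations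

variable {A : Type*} {B : Type*} [Fintype A] [Fintype B] {I : SchoolInstance A B}

namespace StableMatching

instance : Finite (StableMatching I) :=
  Finite.of_injective (fun M : StableMatching I => M.assign)
    fun _ _ h => StableMatching.ext h

theorem some_mem_pairs {M : StableMatching I} {a : A} {y : Option B} :
    (some a, y) ∈ M.pairs ↔ y = M.assign a := by
  constructor
  · rintro (⟨a', h⟩ | ⟨b, x, hx, h⟩)
    · simp only [Prod.mk.injEq, Option.some.injEq] at h
      rw [h.2, h.1]
    · simp only [Prod.mk.injEq] at h
      rw [← h.1, some_mem_partners] at hx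
      rw [h.2, hx]
  · rintro rfl
    exact Or.inl ⟨a, rfl⟩

theorem none_mem_pairs_congr (M N : StableMatching I) {y : Option B} :
    (none, y) ∈ M.pairs ↔ (none, y) ∈ N.pairs := by
  have key : ∀ M : StableMatching I, (none, y) ∈ M.pairs ↔
      ∃ b, y = some b ∧ (M.students b).card < I.quota b := by
    intro M
    simp [Matching.pairs, ← none_mem_partners, and_comm]
  simp only [key, card_students_congr M N]

theorem mem_pairs_diff {M N : StableMatching I} {p : Option A × Option B} :
    p ∈ M.pairs \ N.pairs ↔
      ∃ a, p = (some a, M.assign a) ∧ M.assign a ≠ N.assign a := by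
  obtain ⟨x, y⟩ := p
  cases x with
  | none => simp [none_mem_pairs_congr M N]
  | some a =>
    simp only [Set.mem_sdiff, some_mem_pairs, Prod.mk.injEq, Option.some.injEq]
    constructor
    · rintro ⟨rfl, h⟩
      exact ⟨a, ⟨rfl, rfl⟩, h⟩
    · rintro ⟨a', ⟨rfl, rfl⟩, h⟩
      exact ⟨rfl, h⟩

end StableMatching

open StableMatching

theorem rotation_eq_of_assign {M M' N N' : StableMatching I} (hM : M' ⋖ M) (hN : N' ⋖ N)
    (h : ∀ a, (M.assign a = N.assign a ∧ M'.assign a = N'.assign a) ∨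
      (M.assign a = M'.assign a ∧ N.assign a = N'.assign a)) :
    rotation M M' hM = rotation N N' hN := by
  refine Rotation.ext (Prod.ext (Set.ext fun p => ?_) (Set.ext fun p => ?_)) <;>
  · simp only [rotation, rotationPair, mem_pairs_diff]
    refine exists_congr fun a => ?_
    rcases h a with h | h
    · rw [h.1, h.2]
    · simp [h.1, h.2]

theorem assign_eq_of_rotation_eq {M M' N N' : StableMatching I} {hM : M' ⋖ M} {hN : N' ⋖ N}
    (h : rotation M M' hM = rotation N N' hN) {a : A} (ha : N.assign a ≠ N'.assign a) :
    M.assign a = N.assign a ∧ M'.assign a = N'.assign a := by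
  have h1 : M.pairs \ M'.pairs = N.pairs \ N'.pairs := congrArg (fun ρ => ρ.val.1) h
  have h2 : M'.pairs \ M.pairs = N'.pairs \ N.pairs := congrArg (fun ρ => ρ.val.2) h
  have h3 : (some a, N.assign a) ∈ M.pairs \ M'.pairs := by
    rw [h1, mem_pairs_diff]; exact ⟨a, rfl, ha⟩
  have h4 : (some a, N'.assign a) ∈ M'.pairs \ M.pairs := by
    rw [h2, mem_pairs_diff]; exact ⟨a, rfl, ha.symm⟩
  exact ⟨(some_mem_pairs.1 h3.1).symm, (some_mem_pairs.1 h4.1).symm⟩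

theorem exists_assign_ne_of_lt {M M' : StableMatching I} (h : M' < M) :
    ∃ a, M.assign a ≠ M'.assign a := by
  by_contra! h'
  exact h.ne (ext_assign fun a => (h' a).symm)

theorem rk_lt_of_assign_ne {M M' : StableMatching I} (h : M' ≤ M) {a : A}
    (ha : M.assign a ≠ M'.assign a) : M'.rk a < M.rk a :=
  lt_of_le_of_ne (le_iff_rk.1 h a) fun h' => ha (rk_eq_iff.1 h'.symm)

/-- If the ranges `[N', N]` and `[P', P]` of two covering pairs overlap at some student, then the
range `[P', P]` contains `[N', N]` wherever the latter is nondegenerate. -/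
theorem rk_of_covBy_of_overlap {N N' P P' : StableMatching I} (hN : N' ⋖ N)
    {a : A} (h1 : N'.rk a < N.rk a) (h2 : P'.rk a ≤ N'.rk a) (h3 : N'.rk a < P.rk a) (x : A) :
    max (N'.rk x) (min (N.rk x) (P.rk x)) = N.rk x ∧ min (N.rk x) (P'.rk x) ≤ N'.rk x := by
  -- The matching `N' ∨ (N ∧ Q)` lies between `N'` and `N`, so it is one of them. The ranks at `a`
  -- decide which: `N` for `Q = P`, and `N'` for `Q = P'`.
  have key : ∀ Q : StableMatching I, ∃ J : StableMatching I,
      (J = N' ∨ J = N) ∧ ∀ x, J.rk x = max (N'.rk x) (min (N.rk x) (Q.rk x)) := by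
    intro Q
    obtain ⟨K, hK⟩ := exists_inf N Q
    obtain ⟨J, hJ⟩ := exists_sup N' K
    refine ⟨J, hN.eq_or_eq ?_ ?_, fun x => by rw [hJ, hK]⟩
    · exact le_iff_rk.2 fun x => by rw [hJ]; exact le_max_left _ _
    · refine le_iff_rk.2 fun x => ?_
      rw [hJ, hK]
      exact max_le (le_iff_rk.1 hN.le x) (min_le_left _ _)
  constructor
  · obtain ⟨J, rfl | rfl, hJ⟩ := key P
    · have := hJ a
      omega
    · exact (hJ x).symm
  · obtain ⟨J, rfl | rfl, hJ⟩ := key P'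
    · have := hJ x
      omega
    · have := hJ a
      omega

/-- Once the lower ends agree at `a`, the overlap lemma applies in both directions, so at every
student either the two ranges coincide or both are degenerate. -/
theorem rotation_eq_of_overlap {N N' P P' : StableMatching I} (hN : N' ⋖ N) (hP : P' ⋖ P)
    {a : A} (h1 : N'.rk a < N.rk a) (h2 : P'.rk a ≤ N'.rk a) (h3 : N'.rk a < P.rk a) :
    rotation P P' hP = rotation N N' hN := by
  have key : N.rk a ≤ P.rk a ∧ P'.rk a = N'.rk a → ∀ x,
      (P.rk x = N.rk x ∧ P'.rk x = N'.rk x) ∨ (P.rk x = P'.rk x ∧ N.rk x = N'.rk x) := by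
    intro h4 x
    have h5 := rk_of_covBy_of_overlap hN h1 h2 h3 x
    have h6 := rk_of_covBy_of_overlap hP (P := N) (P' := N') (a := a) (by omega) (by omega)
      (by omega) x
    have h7 := le_iff_rk.1 hN.le x
    have h8 := le_iff_rk.1 hP.le x
    omega
  refine rotation_eq_of_assign hP hN fun x => ?_
  simp only [← rk_eq_iff]
  refine key ?_ x
  have h5 := rk_of_covBy_of_overlap hN h1 h2 h3 a
  refine ⟨by omega, le_antisymm h2 ?_⟩
  -- Otherwise `P' ∨ (P ∧ N')` has at `a` the rank of `N'`, strictly between those of `P'` and `P`,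
  -- although it must equal one of the latter two.
  by_contra h6
  obtain ⟨K, hK⟩ := exists_inf P N'
  obtain ⟨J, hJ⟩ := exists_sup P' K
  have hJ' : J = P' ∨ J = P := by
    refine hP.eq_or_eq (le_iff_rk.2 fun x => by rw [hJ]; exact le_max_left _ _)
      (le_iff_rk.2 fun x => ?_)
    rw [hJ, hK]
    exact max_le (le_iff_rk.1 hP.le x) (min_le_left _ _)
  have h7 := hJ a
  have h8 := hK a
  rcases hJ' with rfl | rfl <;> omega

theorem exists_isTop (M : StableMatching I) : ∃ T : StableMatching I, IsTop T := by
  obtain ⟨T, hT⟩ := (Set.finite_univ (α := StableMatching I)).exists_maximal ⟨M, trivial⟩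
  refine ⟨T, fun N => ?_⟩
  obtain ⟨J, hJ⟩ := exists_sup T N
  have h1 : T ≤ J := le_iff_rk.2 fun a => by rw [hJ]; exact le_max_left _ _
  have h2 : N ≤ J := le_iff_rk.2 fun a => by rw [hJ]; exact le_max_right _ _
  exact h2.trans (hT.2 trivial h1)

theorem exists_isElimination (M : StableMatching I) : ∃ R, IsElimination R M := by
  obtain ⟨T, hT⟩ := exists_isTop M
  induction M using WellFoundedGT.induction with
  | ind M ih =>
    rcases (hT M).eq_or_lt with rfl | h
    · exact ⟨∅, IsElimination.top _ hT⟩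
    · obtain ⟨P, hP, -⟩ := exists_covBy_le_of_lt h
      obtain ⟨R, hR⟩ := ih P hP.lt
      exact ⟨_, IsElimination.step R P M hR hP⟩

theorem IsElimination.exists_covBy {R : Set (Rotation I)} {M : StableMatching I}
    (h : IsElimination R M) {ρ : Rotation I} (hρ : ρ ∈ R) :
    ∃ (P P' : StableMatching I) (hP : P' ⋖ P), M ≤ P' ∧ ρ = rotation P P' hP := by
  induction h with
  | top M hM => exact absurd hρ (Set.notMem_empty _)
  | step R M M' hR hM ih =>
    rcases hρ with rfl | hρ
    · exact ⟨M, M', hM, le_rfl, rfl⟩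
    · obtain ⟨P, P', hP, hle, h⟩ := ih hρ
      exact ⟨P, P', hP, hM.le.trans hle, h⟩

/-- The sequence starts above the level `N'.rk a` at `a` and ends at or below it. The step that
crosses the level overlaps the covering pair at `a`, so it has the same rotation. -/
theorem IsElimination.mem_of_rk_le {R : Set (Rotation I)} {M : StableMatching I}
    (h : IsElimination R M) {N N' : StableMatching I} (hN : N' ⋖ N) {a : A}
    (ha : N.assign a ≠ N'.assign a) (hle : M.rk a ≤ N'.rk a) : rotation N N' hN ∈ R := by
  have ha' := rk_lt_of_assign_ne hN.le ha
  induction h with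
  | top M hM =>
    have := le_iff_rk.1 (hM N) a
    omega
  | step R P P' hR hP ih =>
    by_cases h : P.rk a ≤ N'.rk a
    · exact Or.inr (ih h)
    · exact Or.inl (rotation_eq_of_overlap hN hP ha' hle (not_le.1 h)).symm

theorem rk_le_of_rotation_mem {M N N' : StableMatching I} {hN : N' ⋖ N}
    (h : rotation N N' hN ∈ rotationSet M) {a : A} (ha : N.assign a ≠ N'.assign a) :
    M.rk a ≤ N'.rk a := by
  obtain ⟨R, hR, hmem⟩ := h
  obtain ⟨P, P', hP, hle, he⟩ := hR.exists_covBy hmem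
  rw [← rk_eq_iff.2 (assign_eq_of_rotation_eq he.symm ha).2]
  exact le_iff_rk.1 hle a

/-- A rotation belongs to `R_M` if and only if `M` lies beyond it at any one of the students whom
the rotation moves. -/
theorem rotation_mem_iff {M N N' : StableMatching I} {hN : N' ⋖ N} {a : A}
    (ha : N.assign a ≠ N'.assign a) :
    rotation N N' hN ∈ rotationSet M ↔ M.rk a ≤ N'.rk a := by
  refine ⟨fun h => rk_le_of_rotation_mem h ha, fun h => ?_⟩
  obtain ⟨R, hR⟩ := exists_isElimination M
  exact ⟨R, hR, hR.mem_of_rk_le hN ha h⟩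

/-- Membership of a rotation in `R_M` is decided by the rank of the partner of one student. -/
theorem exists_mem_rotationSet_iff (ρ : Rotation I) :
    ∃ (a : A) (n : ℕ), ∀ M : StableMatching I, ρ ∈ rotationSet M ↔ M.rk a ≤ n := by
  obtain ⟨N, N', hN, h⟩ := ρ.exists_covBy
  obtain rfl : ρ = rotation N N' hN := Rotation.ext h
  obtain ⟨a, ha⟩ := exists_assign_ne_of_lt hN.lt
  exact ⟨a, N'.rk a, fun M => rotation_mem_iff ha⟩

/-- A maximum is at most a threshold iff both terms are; the dual statement for minima gives unions.
-/
theorem rotationSet_sup {M N J : StableMatching I} (hJ : ∀ a, J.rk a = max (M.rk a) (N.rk a)) :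
    rotationSet J = rotationSet M ∩ rotationSet N := by
  ext ρ
  obtain ⟨a, n, h⟩ := exists_mem_rotationSet_iff ρ
  rw [Set.mem_inter_iff, h, h, h, hJ, max_le_iff]

theorem rotationSet_inf {M N K : StableMatching I} (hK : ∀ a, K.rk a = min (M.rk a) (N.rk a)) :
    rotationSet K = rotationSet M ∪ rotationSet N := by
  ext ρ
  obtain ⟨a, n, h⟩ := exists_mem_rotationSet_iff ρ
  rw [Set.mem_union, h, h, h, hK, min_le_iff]

theorem IsElimination.le_of_subset {R : Set (Rotation I)} {M N : StableMatching I}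
    (h : IsElimination R M) (hR : R ⊆ rotationSet N) : N ≤ M := by
  induction h with
  | top M hM => exact hM N
  | step R P P' hP hcov ih =>
    have h1 := ih fun ρ hρ => hR (Or.inr hρ)
    have h2 := hR (Or.inl rfl)
    refine le_iff_rk.2 fun a => ?_
    by_cases ha : P.assign a = P'.assign a
    · rw [← rk_eq_iff.2 ha]; exact le_iff_rk.1 h1 a
    · exact rk_le_of_rotation_mem h2 ha

theorem rotationSet_subset_iff {M N : StableMatching I} :
    rotationSet M ⊆ rotationSet N ↔ N ≤ M := by
  constructor
  · intro h
    obtain ⟨R, hR⟩ := exists_isElimination M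
    exact hR.le_of_subset fun ρ hρ => h ⟨R, hR, hρ⟩
  · intro h ρ hρ
    obtain ⟨a, n, ha⟩ := exists_mem_rotationSet_iff ρ
    rw [ha] at hρ ⊢
    exact (le_iff_rk.1 h a).trans hρ

theorem rotationSet_injective :
    Function.Injective (rotationSet : StableMatching I → Set (Rotation I)) := fun _ _ h =>
  le_antisymm (rotationSet_subset_iff.1 h.ge) (rotationSet_subset_iff.1 h.le)

theorem upperClosed_rotationSet (M : StableMatching I) : UpperClosed (rotationSet M) := by
  rintro ρ hρ ρ' (rfl | h)
  · exact hρ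
  · obtain ⟨R, hR, hmem⟩ := hρ
    obtain ⟨P, P', hP, hle, rfl⟩ := hR.exists_covBy hmem
    exact rotationSet_subset_iff.2 (hle.trans hP.le) (h P ⟨P', hP, rfl⟩)

theorem isLUB_iff_rotationSet {M N J : StableMatching I} :
    IsLUB {M, N} J ↔ rotationSet J = rotationSet M ∩ rotationSet N := by
  obtain ⟨J', hJ'⟩ := exists_sup M N
  have hlub : IsLUB {M, N} J' := by
    simp only [IsLUB, IsLeast, mem_upperBounds, mem_lowerBounds, Set.mem_insert_iff,
      Set.mem_singleton_iff, forall_eq_or_imp, forall_eq, le_iff_rk, hJ']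
    exact ⟨⟨fun a => le_max_left _ _, fun a => le_max_right _ _⟩,
      fun Q hQ a => max_le (hQ.1 a) (hQ.2 a)⟩
  rw [← rotationSet_sup hJ']
  exact ⟨fun h => by rw [h.unique hlub], fun h => by rwa [rotationSet_injective h]⟩

theorem isGLB_iff_rotationSet {M N K : StableMatching I} :
    IsGLB {M, N} K ↔ rotationSet K = rotationSet M ∪ rotationSet N := by
  obtain ⟨K', hK'⟩ := exists_inf M N
  have hglb : IsGLB {M, N} K' := by
    simp only [IsGLB, IsGreatest, mem_upperBounds, mem_lowerBounds, Set.mem_insert_iff,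
      Set.mem_singleton_iff, forall_eq_or_imp, forall_eq, le_iff_rk, hK']
    exact ⟨⟨fun a => min_le_left _ _, fun a => min_le_right _ _⟩,
      fun Q hQ a => le_min (hQ.1 a) (hQ.2 a)⟩
  rw [← rotationSet_inf hK']
  exact ⟨fun h => by rw [h.unique hglb], fun h => by rwa [rotationSet_injective h]⟩

end Rotations

end StableMatchings

namespace StableMatchings

/-! ### Second order expansion of functions on the lower sets of a poset. -/

section SecondOrder

variable {P : Type*} [PartialOrder P]

/-- The first order differential of a function of the lower sets of a partial order. -/
def lowerDiff (φ : Set P → ℝ) (p : P) : ℝ := φ (Set.Iic p) - φ (Set.Iio p)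

/-- The second order differential of a function of the lower sets of a partial order. -/
def lowerDiff₂ (φ : Set P → ℝ) (p q : P) : ℝ :=
  φ (Set.Iic p ∪ Set.Iio q) + φ (Set.Iio p ∪ Set.Iic q) - φ (Set.Iio p ∪ Set.Iio q)
    - φ (Set.Iic p ∪ Set.Iic q)

/-- The mixed differences of `φ` in two directions do not depend on the base point. -/
def HasMixedDiff (φ : Set P → ℝ) (w : P → P → ℝ) : Prop :=
  ∀ (T : Set P) (p q : P), IsLowerSet T → p ∉ T → q ∉ T → p ≠ q → IsLowerSet (insert p T) →
    IsLowerSet (insert q T) →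
      φ (insert p T) + φ (insert q T) - φ T - φ (insert p (insert q T)) = w p q

theorem lowerDiff₂_comm (φ : Set P → ℝ) (p q : P) : lowerDiff₂ φ p q = lowerDiff₂ φ q p := by
  unfold lowerDiff₂
  rw [Set.union_comm (Set.Iic p), Set.union_comm (Set.Iio p), Set.union_comm (Set.Iio p),
    Set.union_comm (Set.Iic p)]
  ring

/-- The sets below `p` are absorbed by those below `q`, so the four terms cancel in pairs. Only
incomparable pairs contribute to the expansion. -/
theorem lowerDiff₂_of_lt (φ : Set P → ℝ) {p q : P} (h : p < q) : lowerDiff₂ φ p q = 0 := by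
  have h1 : Set.Iic p ⊆ Set.Iio q := fun x hx => lt_of_le_of_lt hx h
  have h2 : Set.Iio p ⊆ Set.Iio q := fun x hx => lt_trans hx h
  have h3 : Set.Iic p ⊆ Set.Iic q := h1.trans Set.Iio_subset_Iic_self
  have h4 : Set.Iio p ⊆ Set.Iic q := h2.trans Set.Iio_subset_Iic_self
  unfold lowerDiff₂
  rw [Set.union_eq_self_of_subset_left h1, Set.union_eq_self_of_subset_left h2,
    Set.union_eq_self_of_subset_left h3, Set.union_eq_self_of_subset_left h4]
  ring

theorem lowerDiff₂_of_gt (φ : Set P → ℝ) {p q : P} (h : q < p) : lowerDiff₂ φ p q = 0 := by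
  rw [lowerDiff₂_comm, lowerDiff₂_of_lt φ h]

theorem isLowerSet_insert {T : Set P} (hT : IsLowerSet T) {p : P} (hp : Set.Iio p ⊆ T) :
    IsLowerSet (insert p T) := by
  rintro a b hba (rfl | ha)
  · rcases hba.eq_or_lt with rfl | h
    · exact Or.inl rfl
    · exact Or.inr (hp h)
  · exact Or.inr (hT hba ha)

/-- The base point is `Set.Iio p ∪ Set.Iio q`, the smallest lower set to which either element can be
added. -/
theorem HasMixedDiff.lowerDiff₂_eq {φ : Set P → ℝ} {w : P → P → ℝ} (h : HasMixedDiff φ w)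
    {p q : P} (h1 : ¬ p ≤ q) (h2 : ¬ q ≤ p) : lowerDiff₂ φ p q = w p q := by
  have hl : IsLowerSet (Set.Iio p ∪ Set.Iio q) := (isLowerSet_Iio p).union (isLowerSet_Iio q)
  have h3 : p ∉ Set.Iio p ∪ Set.Iio q := by
    rintro (h | h)
    · exact lt_irrefl p h
    · exact h1 (le_of_lt h)
  have h4 : q ∉ Set.Iio p ∪ Set.Iio q := by
    rintro (h | h)
    · exact h2 (le_of_lt h)
    · exact lt_irrefl q h
  have h5 := h _ p q hl h3 h4 (fun h => h1 h.le) (isLowerSet_insert hl Set.subset_union_left)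
    (isLowerSet_insert hl Set.subset_union_right)
  rw [← h5]
  unfold lowerDiff₂
  simp only [← Set.Iio_insert, Set.insert_union, Set.union_insert]
  rw [Set.insert_comm q p]

theorem HasMixedDiff.lowerDiff₂_nonneg {φ : Set P → ℝ} {w : P → P → ℝ} (h : HasMixedDiff φ w)
    (hw : ∀ p q, 0 ≤ w p q) {p q : P} (hpq : p ≠ q) : 0 ≤ lowerDiff₂ φ p q := by
  by_cases h1 : p ≤ q
  · exact (lowerDiff₂_of_lt φ (lt_of_le_of_ne h1 hpq)).ge
  by_cases h2 : q ≤ p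
  · exact (lowerDiff₂_of_gt φ (lt_of_le_of_ne h2 hpq.symm)).ge
  rw [h.lowerDiff₂_eq h1 h2]
  exact hw p q

variable [DecidableEq P]

theorem isLowerSet_erase {T : Finset P} (hT : IsLowerSet (T : Set P)) {p : P}
    (hp : ∀ q ∈ T, ¬ p < q) : IsLowerSet ((T.erase p : Finset P) : Set P) := by
  intro a b hba ha
  simp only [Finset.coe_erase, Set.mem_sdiff, Finset.mem_coe, Set.mem_singleton_iff] at ha ⊢
  refine ⟨hT hba ha.1, ?_⟩
  rintro rfl
  exact hp a ha.1 (lt_of_le_of_ne hba (Ne.symm ha.2))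

/-- The increment of `φ` at `p` changes by the mixed difference whenever an element not below `p` is
taken out of `T`. Removing all of them leaves `Set.Iio p`, where the increment is the first order
differential. -/
theorem HasMixedDiff.sub_eq {φ : Set P → ℝ} {w : P → P → ℝ} (h : HasMixedDiff φ w) {p : P}
    (T : Finset P) (hT : IsLowerSet (T : Set P)) (hp : Set.Iio p ⊆ (T : Set P)) (hpT : p ∉ T) :
    φ (insert p (T : Set P)) - φ T = lowerDiff φ p - ∑ q ∈ T, lowerDiff₂ φ p q := by
  classical
  induction hn : T.card using Nat.strong_induction_on generalizing T with
  | _ n ih =>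
    by_cases hT' : ∃ q ∈ T, ¬ q < p
    · obtain ⟨r, hr, hrp⟩ := hT'
      obtain ⟨q, hq⟩ := (T.filter fun q => ¬ q < p).exists_maximal ⟨r, by simp [hr, hrp]⟩
      have hq1 : q ∈ T := (Finset.mem_filter.1 hq.1).1
      have hq2 : ¬ q < p := (Finset.mem_filter.1 hq.1).2
      -- An element above `q` is not below `p` either, so `q` is maximal in all of `T`.
      have hmax : ∀ s ∈ T, ¬ q < s := by
        intro s hs hqs
        refine hqs.not_ge (hq.2 (Finset.mem_filter.2 ⟨hs, fun hsp => ?_⟩) hqs.le)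
        exact hq2 (hqs.trans hsp)
      have hl := isLowerSet_erase hT hmax
      have hsub : Set.Iio p ⊆ ((T.erase q : Finset P) : Set P) := by
        intro x hx
        simp only [Finset.coe_erase, Set.mem_sdiff, Finset.mem_coe, Set.mem_singleton_iff]
        refine ⟨hp hx, ?_⟩
        rintro rfl
        exact hq2 hx
      have hne : p ≠ q := fun h => hpT (h ▸ hq1)
      have hp1 : p ∉ T.erase q := fun h => hpT (Finset.mem_of_mem_erase h)
      have hins : insert q ((T.erase q : Finset P) : Set P) = T := by
        rw [← Finset.coe_insert, Finset.insert_erase hq1]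
      have h1 := ih _ (by rw [← hn]; exact Finset.card_erase_lt_of_mem hq1) (T.erase q) hl hsub
        hp1 rfl
      have h2 := h ((T.erase q : Finset P) : Set P) p q hl (mt Finset.mem_coe.1 hp1) (by simp) hne
        (isLowerSet_insert hl hsub) (by rw [hins]; exact hT)
      rw [hins] at h2
      have h3 : lowerDiff₂ φ p q = w p q :=
        h.lowerDiff₂_eq (fun h => hpT (hT h hq1))
          (fun h => hq2 (lt_of_le_of_ne h hne.symm))
      rw [← Finset.add_sum_erase T _ hq1]
      linarith
    · push Not at hT'
      have hTeq : (T : Set P) = Set.Iio p := Set.Subset.antisymm (fun x hx => hT' x hx) hp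
      rw [Finset.sum_eq_zero fun q hq => lowerDiff₂_of_gt φ (hT' q hq), hTeq, Set.Iio_insert]
      simp [lowerDiff]

/-- Induction by removing a maximal `p`. The factor one half compensates for the ordered pairs `(p,
q)` and `(q, p)`, which carry equal second differentials. -/
theorem HasMixedDiff.expansion {φ : Set P → ℝ} {w : P → P → ℝ} (h : HasMixedDiff φ w)
    (T : Finset P) (hT : IsLowerSet (T : Set P)) :
    φ T = φ ∅ + ∑ p ∈ T, lowerDiff φ p -
      (1 / 2) * ∑ p ∈ T, ∑ q ∈ T, if p ≠ q then lowerDiff₂ φ p q else 0 := by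
  classical
  induction hn : T.card using Nat.strong_induction_on generalizing T with
  | _ n ih =>
    rcases T.eq_empty_or_nonempty with rfl | hne
    · simp
    · obtain ⟨p, hp⟩ := T.exists_maximal hne
      have hmax : ∀ s ∈ T, ¬ p < s := fun s hs hps => hps.not_ge (hp.2 hs hps.le)
      have hl := isLowerSet_erase hT hmax
      have hp1 : p ∉ T.erase p := by simp
      have hsub : Set.Iio p ⊆ ((T.erase p : Finset P) : Set P) := by
        intro x hx
        simp only [Finset.coe_erase, Set.mem_sdiff, Finset.mem_coe, Set.mem_singleton_iff]
        exact ⟨hT (le_of_lt hx) hp.1, ne_of_lt hx⟩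
      have h1 := ih _ (by rw [← hn]; exact Finset.card_erase_lt_of_mem hp.1) (T.erase p) hl rfl
      have h2 := h.sub_eq (T.erase p) hl hsub hp1
      rw [← Finset.coe_insert, Finset.insert_erase hp.1] at h2
      have h3 : ∀ q ∈ T.erase p, (∑ r ∈ T, if q ≠ r then lowerDiff₂ φ q r else 0) =
          lowerDiff₂ φ p q + ∑ r ∈ T.erase p, if q ≠ r then lowerDiff₂ φ q r else 0 := by
        intro q hq
        rw [← Finset.add_sum_erase T _ hp.1, if_pos (Finset.ne_of_mem_erase hq),
          lowerDiff₂_comm]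
      have h4 : (∑ r ∈ T, if p ≠ r then lowerDiff₂ φ p r else 0) =
          ∑ r ∈ T.erase p, lowerDiff₂ φ p r := by
        rw [← Finset.add_sum_erase T _ hp.1, if_neg (by simp), zero_add]
        exact Finset.sum_congr rfl fun r hr => if_pos (Finset.ne_of_mem_erase hr).symm
      rw [← Finset.add_sum_erase T (lowerDiff φ) hp.1, ← Finset.add_sum_erase T _ hp.1,
        Finset.sum_congr rfl h3, Finset.sum_add_distrib, h4]
      linarith

end SecondOrder

/-! ### Members of a sublattice as lower sets of proper meta-rotations. -/

section MetaRotations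

variable {A : Type*} {B : Type*} [Fintype A] [Fintype B] {I : SchoolInstance A B}
  {F : Set (StableMatching I)}

theorem MetaRotation.subset_iff (θ : MetaRotation F) {ρ : Rotation I} (hρ : ρ ∈ θ.carrier)
    {M : StableMatching I} (hM : M ∈ F) : θ.carrier ⊆ rotationSet M ↔ ρ ∈ rotationSet M := by
  refine ⟨fun h => h hρ, fun h ρ' hρ' => ?_⟩
  obtain ⟨σ, hσ⟩ := θ.isClass
  rw [hσ] at hρ hρ'
  exact (hρ' M hM).1 ((hρ M hM).2 h)

theorem MetaRotation.nonempty (θ : MetaRotation F) : θ.carrier.Nonempty := by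
  obtain ⟨σ, hσ⟩ := θ.isClass
  exact ⟨σ, by rw [hσ]; exact fun M _ => Iff.rfl⟩

theorem MetaRotation.eq_of_iff {θ θ' : MetaRotation F} {ρ ρ' : Rotation I}
    (hρ : ρ ∈ θ.carrier) (hρ' : ρ' ∈ θ'.carrier) (h : MetaEquiv F ρ ρ') : θ = θ' := by
  obtain ⟨σ, hσ⟩ := θ.isClass
  obtain ⟨τ, hτ⟩ := θ'.isClass
  rw [hσ] at hρ
  rw [hτ] at hρ'
  apply MetaRotation.ext
  rw [hσ, hτ]
  ext x
  exact forall₂_congr fun M hM => by rw [hρ M hM, h M hM, ← hρ' M hM]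

theorem MetaRotation.eq_of_mem {θ θ' : MetaRotation F} {ρ : Rotation I}
    (hρ : ρ ∈ θ.carrier) (hρ' : ρ ∈ θ'.carrier) : θ = θ' :=
  MetaRotation.eq_of_iff hρ hρ' fun _ _ => Iff.rfl

theorem ProperMetaRotation.toMetaRotation_injective :
    Function.Injective (ProperMetaRotation.toMetaRotation (F := F)) := fun _ _ h =>
  ProperMetaRotation.ext (congrArg MetaRotation.carrier h)

/-- The meta-rotation of a rotation. -/
def metaOf (F : Set (StableMatching I)) (ρ : Rotation I) : MetaRotation F :=
  ⟨{ρ' | MetaEquiv F ρ ρ'}, ρ, rfl⟩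

theorem mem_metaOf (ρ : Rotation I) : ρ ∈ (metaOf F ρ).carrier := fun _ _ => Iff.rfl

theorem metaOf_carrier_of_mem_initial {ρ : Rotation I} (h : ρ ∈ initialMeta F) :
    (metaOf F ρ).carrier = initialMeta F := by
  ext ρ'
  exact forall₂_congr fun M hM => by simp [h M hM]

theorem metaOf_carrier_of_mem_final {ρ : Rotation I} (h : ρ ∈ finalMeta F) :
    (metaOf F ρ).carrier = finalMeta F := by
  ext ρ'
  exact forall₂_congr fun M hM => by simp [h M hM]

theorem ProperMetaRotation.notMem_initial (θ : ProperMetaRotation F) {ρ : Rotation I}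
    (hρ : ρ ∈ θ.carrier) : ρ ∉ initialMeta F := fun h =>
  θ.ne_initial (by
    rw [← metaOf_carrier_of_mem_initial h, MetaRotation.eq_of_mem hρ (mem_metaOf ρ)])

theorem ProperMetaRotation.notMem_final (θ : ProperMetaRotation F) {ρ : Rotation I}
    (hρ : ρ ∈ θ.carrier) : ρ ∉ finalMeta F := fun h =>
  θ.ne_final (by
    rw [← metaOf_carrier_of_mem_final h, MetaRotation.eq_of_mem hρ (mem_metaOf ρ)])

theorem exists_proper_of_notMem {ρ : Rotation I} (h0 : ρ ∉ initialMeta F)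
    (hz : ρ ∉ finalMeta F) : ∃ θ : ProperMetaRotation F, ρ ∈ θ.carrier :=
  ⟨⟨metaOf F ρ, fun h => h0 (h ▸ mem_metaOf ρ), fun h => hz (h ▸ mem_metaOf ρ)⟩, mem_metaOf ρ⟩

/-- The order is reversed: what must be eliminated earlier is smaller. Upper-closed sets become
lower sets, and the sets that define `M^θ` and `M_θ` become `Set.Iic θ` and `Set.Iio θ`. -/
instance : PartialOrder (ProperMetaRotation F) where
  le θ θ' := θ.Above θ'
  le_refl _ _ _ h := h
  le_trans _ _ _ h h' M hM hs := h M hM (h' M hM hs)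
  le_antisymm θ θ' h h' := by
    obtain ⟨ρ, hρ⟩ := θ.nonempty
    obtain ⟨ρ', hρ'⟩ := θ'.nonempty
    apply ProperMetaRotation.toMetaRotation_injective
    refine MetaRotation.eq_of_iff hρ hρ' fun M hM => ?_
    rw [← θ.subset_iff hρ hM, ← θ'.subset_iff hρ' hM]
    exact ⟨h' M hM, h M hM⟩

/-- The rotations of a set of proper meta-rotations, together with the initial ones. -/
def rotationsOf (Θ : Set (ProperMetaRotation F)) : Set (Rotation I) :=
  initialMeta F ∪ ⋃ θ ∈ Θ, θ.carrier

theorem mem_rotationsOf_iff {Θ : Set (ProperMetaRotation F)} {θ : ProperMetaRotation F}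
    {ρ : Rotation I} (hρ : ρ ∈ θ.carrier) : ρ ∈ rotationsOf Θ ↔ θ ∈ Θ := by
  constructor
  · rintro (h | h)
    · exact absurd h (θ.notMem_initial hρ)
    · simp only [Set.mem_iUnion] at h
      obtain ⟨θ', h, h'⟩ := h
      rwa [ProperMetaRotation.toMetaRotation_injective (MetaRotation.eq_of_mem hρ h')]
  · intro h
    exact Or.inr (Set.mem_biUnion h hρ)

theorem rotationsOf_injective :
    Function.Injective (rotationsOf : Set (ProperMetaRotation F) → Set (Rotation I)) := by
  intro Θ Θ' h
  ext θ
  obtain ⟨ρ, hρ⟩ := θ.nonempty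
  rw [← mem_rotationsOf_iff hρ, h, mem_rotationsOf_iff hρ]

theorem rotationsOf_insert (θ : ProperMetaRotation F) (Θ : Set (ProperMetaRotation F)) :
    rotationsOf (insert θ Θ) = rotationsOf Θ ∪ θ.carrier := by
  simp only [rotationsOf, Set.biUnion_insert]
  rw [Set.union_assoc, Set.union_comm θ.carrier]

theorem disjoint_rotationsOf {θ : ProperMetaRotation F} {Θ : Set (ProperMetaRotation F)}
    (h : θ ∉ Θ) : Disjoint (rotationsOf Θ) θ.carrier :=
  Set.disjoint_left.2 fun _ h1 h2 => h ((mem_rotationsOf_iff h2).1 h1)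

theorem rotationsOf_union (Θ Θ' : Set (ProperMetaRotation F)) :
    rotationsOf (Θ ∪ Θ') = rotationsOf Θ ∪ rotationsOf Θ' := by
  simp only [rotationsOf, Set.biUnion_union]
  rw [← Set.union_union_distrib_left]

theorem mem_metaSet_iff {M : F} {θ : ProperMetaRotation F} {ρ : Rotation I}
    (hρ : ρ ∈ θ.carrier) : θ ∈ metaSet M ↔ ρ ∈ rotationSet M.1 :=
  θ.subset_iff hρ M.2

/-- A rotation is always eliminated, never eliminated, or in a proper class, which lies inside or
outside `rotationSet M.1` as a whole. -/
theorem rotationsOf_metaSet (M : F) : rotationsOf (metaSet M) = rotationSet M.1 := by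
  ext ρ
  by_cases h0 : ρ ∈ initialMeta F
  · exact iff_of_true (Or.inl h0) (h0 M.1 M.2)
  by_cases hz : ρ ∈ finalMeta F
  · refine iff_of_false ?_ (hz M.1 M.2)
    rintro (h | h)
    · exact h0 h
    · simp only [Set.mem_iUnion] at h
      obtain ⟨θ, -, h⟩ := h
      exact θ.notMem_final h hz
  obtain ⟨θ, hθ⟩ := exists_proper_of_notMem h0 hz
  rw [mem_rotationsOf_iff hθ, mem_metaSet_iff hθ]

theorem rotationSet_eq_rotationsOf_iff {M : F} {Θ : Set (ProperMetaRotation F)} :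
    rotationSet M.1 = rotationsOf Θ ↔ metaSet M = Θ := by
  rw [← rotationsOf_metaSet, rotationsOf_injective.eq_iff]

theorem metaSet_injective : Function.Injective (metaSet : F → Set (ProperMetaRotation F)) := by
  intro M N h
  apply Subtype.ext
  apply rotationSet_injective
  rw [← rotationsOf_metaSet, ← rotationsOf_metaSet, h]

theorem isLowerSet_metaSet (M : F) : IsLowerSet (metaSet M) := fun _ _ h h' => h M.1 M.2 h'

variable (hF : IsStableSublattice F)
include hF

theorem IsStableSublattice.exists_inter (M N : F) :
    ∃ J : F, rotationSet J.1 = rotationSet M.1 ∩ rotationSet N.1 := by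
  obtain ⟨J, hJ, h⟩ := (hF M.1 M.2 N.1 N.2).1
  exact ⟨⟨J, hJ⟩, isLUB_iff_rotationSet.1 h⟩

theorem IsStableSublattice.exists_union (M N : F) :
    ∃ K : F, rotationSet K.1 = rotationSet M.1 ∪ rotationSet N.1 := by
  obtain ⟨K, hK, h⟩ := (hF M.1 M.2 N.1 N.2).2
  exact ⟨⟨K, hK⟩, isGLB_iff_rotationSet.1 h⟩

/-- Among the members of `F` that satisfy a property closed under joins there is a largest one. -/
theorem IsStableSublattice.exists_largest (p : StableMatching I → Prop) (hne : ∃ M ∈ F, p M)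
    (hp : ∀ M N J : StableMatching I, p M → p N →
      rotationSet J = rotationSet M ∩ rotationSet N → p J) :
    ∃ M : F, p M.1 ∧ ∀ N ∈ F, p N → rotationSet M.1 ⊆ rotationSet N := by
  obtain ⟨T, hT⟩ := (Set.toFinite {M | M ∈ F ∧ p M}).exists_maximal hne
  refine ⟨⟨T, hT.1.1⟩, hT.1.2, fun N hN hpN => ?_⟩
  obtain ⟨J, hJ⟩ := hF.exists_inter ⟨T, hT.1.1⟩ ⟨N, hN⟩
  have h1 : T ≤ J.1 := rotationSet_subset_iff.1 (by rw [hJ]; exact Set.inter_subset_left)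
  have h2 := hT.2 ⟨J.2, hp _ _ _ hT.1.2 hpN hJ⟩ h1
  exact (rotationSet_subset_iff.2 h2).trans (by rw [hJ]; exact Set.inter_subset_right)

theorem IsStableSublattice.exists_metaSet_eq_empty [Nonempty F] :
    ∃ M : F, metaSet M = ∅ ∧ IsGreatest F M.1 := by
  obtain ⟨M, -, h⟩ := hF.exists_largest (fun _ => True)
    (let ⟨M⟩ := ‹Nonempty F›; ⟨M.1, M.2, trivial⟩) (fun _ _ _ _ _ _ => trivial)
  refine ⟨M, Set.eq_empty_of_forall_notMem fun θ hθ => ?_, M.2, fun N hN =>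
    rotationSet_subset_iff.1 (h N hN trivial)⟩
  obtain ⟨ρ, hρ⟩ := θ.nonempty
  exact θ.notMem_initial hρ fun N hN => h N hN trivial (hθ hρ)

/-- The witness is the largest member of `F` that eliminates `θ`. Its rotation set is contained in
that of every other such member, so what it eliminates is above `θ` in the sense of `Above`. -/
theorem IsStableSublattice.exists_metaSet_eq_Iic (θ : ProperMetaRotation F) :
    ∃ M : F, metaSet M = Set.Iic θ := by
  have hne : ∃ M ∈ F, θ.carrier ⊆ rotationSet M := by
    obtain ⟨ρ, hρ⟩ := θ.nonempty
    have h : ¬ ∀ M ∈ F, ρ ∉ rotationSet M := θ.notMem_final hρ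
    push Not at h
    obtain ⟨M, hM, h⟩ := h
    exact ⟨M, hM, (θ.subset_iff hρ hM).2 h⟩
  obtain ⟨M, hM, h⟩ := hF.exists_largest (fun M => θ.carrier ⊆ rotationSet M) hne
    (fun M N J h h' hJ => by rw [hJ]; exact Set.subset_inter h h')
  refine ⟨M, Set.Subset.antisymm (fun θ' hθ' N hN hs => ?_) fun θ' hθ' => hθ' M.1 M.2 hM⟩
  exact Set.Subset.trans hθ' (h N hN hs)

/-- Every lower set of proper meta-rotations is the set of a member of `F`. -/
theorem IsStableSublattice.exists_metaSet_eq [Nonempty F] {Θ : Set (ProperMetaRotation F)}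
    (hΘ : IsLowerSet Θ) : ∃ M : F, metaSet M = Θ := by
  -- A lower set is a union of principal ones, and finite unions are realized by meets inside `F`,
  -- starting from the largest member.
  suffices h : ∀ S : Set (ProperMetaRotation F), ∃ M : F, metaSet M = ⋃ θ ∈ S, Set.Iic θ by
    obtain ⟨M, hM⟩ := h Θ
    refine ⟨M, hM.trans (Set.Subset.antisymm ?_ fun θ hθ => Set.mem_biUnion hθ Set.self_mem_Iic)⟩
    exact Set.iUnion₂_subset fun θ hθ x hx => hΘ hx hθ
  intro S
  induction S, Set.toFinite S using Set.Finite.induction_on with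
  | empty =>
    obtain ⟨M, hM, -⟩ := hF.exists_metaSet_eq_empty
    exact ⟨M, by simpa using hM⟩
  | @insert θ S _ _ ih =>
    obtain ⟨M, hM⟩ := ih
    obtain ⟨N, hN⟩ := hF.exists_metaSet_eq_Iic θ
    obtain ⟨K, hK⟩ := hF.exists_union N M
    refine ⟨K, ?_⟩
    rw [Set.biUnion_insert, ← hM, ← hN, ← rotationSet_eq_rotationsOf_iff, hK,
      rotationsOf_union, rotationsOf_metaSet, rotationsOf_metaSet]

variable [Nonempty F]

theorem IsStableSublattice.metaSet_matchingOf {Θ : Set (ProperMetaRotation F)}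
    (hΘ : IsLowerSet Θ) : metaSet (matchingOf Θ) = Θ := by
  rw [← rotationSet_eq_rotationsOf_iff]
  obtain ⟨M, hM⟩ := hF.exists_metaSet_eq hΘ
  exact Classical.epsilon_spec (p := fun M : F => rotationSet M.1 = rotationsOf Θ)
    ⟨M, rotationSet_eq_rotationsOf_iff.2 hM⟩

theorem IsStableSublattice.matchingOf_metaSet (M : F) : matchingOf (metaSet M) = M :=
  metaSet_injective (hF.metaSet_matchingOf (isLowerSet_metaSet M))

theorem IsStableSublattice.metaSet_meet (M N : F) : metaSet (meet M N) = metaSet M ∪ metaSet N := by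
  obtain ⟨K, hK, h⟩ := (hF M.1 M.2 N.1 N.2).2
  have h1 : IsGLB {M.1, N.1} (meet M N).1 :=
    Classical.epsilon_spec (p := fun K : F => IsGLB {M.1, N.1} K.1) ⟨⟨K, hK⟩, h⟩
  rw [← rotationSet_eq_rotationsOf_iff, isGLB_iff_rotationSet.1 h1, rotationsOf_union,
    rotationsOf_metaSet, rotationsOf_metaSet]

theorem IsStableSublattice.metaSet_largest : metaSet (largest F) = ∅ := by
  obtain ⟨M, hM, h⟩ := hF.exists_metaSet_eq_empty
  have h1 : IsGreatest F (largest F).1 :=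
    Classical.epsilon_spec (p := fun M : F => IsGreatest F M.1) ⟨M, h⟩
  rw [← hM, Subtype.ext (h1.unique h)]

/-- This turns the meets in `diff2` into unions of lower sets, as in `lowerDiff₂`. -/
theorem IsStableSublattice.meet_matchingOf {Θ Θ' : Set (ProperMetaRotation F)}
    (hΘ : IsLowerSet Θ) (hΘ' : IsLowerSet Θ') :
    meet (matchingOf Θ) (matchingOf Θ') = matchingOf (Θ ∪ Θ') := by
  apply metaSet_injective
  rw [hF.metaSet_meet, hF.metaSet_matchingOf hΘ, hF.metaSet_matchingOf hΘ',
    hF.metaSet_matchingOf (hΘ.union hΘ')]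

theorem IsStableSublattice.matchingOf_empty : matchingOf (∅ : Set (ProperMetaRotation F)) = largest F := by
  rw [← hF.matchingOf_metaSet (largest F), hF.metaSet_largest]

omit hF in
theorem matchingUpper_eq (θ : ProperMetaRotation F) :
    matchingUpper θ = matchingOf (Set.Iic θ) := rfl

omit hF in
theorem matchingLower_eq (θ : ProperMetaRotation F) :
    matchingLower θ = matchingOf (Set.Iio θ) := by
  unfold matchingLower
  congr 1
  ext θ'
  exact (lt_iff_le_and_ne (a := θ') (b := θ)).symm

omit hF in
theorem diff1_eq_lowerDiff (f : F → ℝ) (θ : ProperMetaRotation F) :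
    diff1 f θ = lowerDiff (fun Θ => f (matchingOf Θ)) θ := by
  rw [diff1, lowerDiff, matchingUpper_eq, matchingLower_eq]

theorem IsStableSublattice.diff2_eq_lowerDiff₂ (f : F → ℝ) (θ θ' : ProperMetaRotation F) :
    diff2 f θ θ' = lowerDiff₂ (fun Θ => f (matchingOf Θ)) θ θ' := by
  simp only [diff2, lowerDiff₂, matchingUpper_eq, matchingLower_eq]
  rw [hF.meet_matchingOf (isLowerSet_Iic _) (isLowerSet_Iio _),
    hF.meet_matchingOf (isLowerSet_Iio _) (isLowerSet_Iic _),
    hF.meet_matchingOf (isLowerSet_Iio _) (isLowerSet_Iio _),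
    hF.meet_matchingOf (isLowerSet_Iic _) (isLowerSet_Iic _)]

omit hF in
open Classical in
theorem secondOrderExpansion_eq (f : F → ℝ) (M : F) :
    secondOrderExpansion f M = f (largest F) +
      ∑ θ ∈ Finset.univ.filter (· ∈ metaSet M), diff1 f θ -
      (1 / 2) * ∑ θ ∈ Finset.univ.filter (· ∈ metaSet M),
        ∑ θ' ∈ Finset.univ.filter (· ∈ metaSet M), if θ ≠ θ' then diff2 f θ θ' else 0 := by
  unfold secondOrderExpansion
  simp only [Finset.sum_filter]
  congr 3
  funext θ
  by_cases h : θ ∈ metaSet M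
  · rw [if_pos h]
    refine Finset.sum_congr rfl fun θ' _ => ?_
    rw [← ite_and]
    simp [h]
  · simp [h]

/-- A function with constant mixed differences equals its second order expansion. -/
theorem IsStableSublattice.eq_secondOrderExpansion {f : F → ℝ}
    {w : ProperMetaRotation F → ProperMetaRotation F → ℝ}
    (h : HasMixedDiff (fun Θ => f (matchingOf Θ)) w) (M : F) :
    f M = secondOrderExpansion f M := by
  classical
  have h1 : ((Finset.univ.filter (· ∈ metaSet M) : Finset (ProperMetaRotation F)) :
      Set (ProperMetaRotation F)) = metaSet M := by ext; simp
  have h2 := h.expansion (Finset.univ.filter (· ∈ metaSet M)) (by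
    rw [h1]; exact isLowerSet_metaSet M)
  rw [h1] at h2
  simp only [hF.matchingOf_metaSet, hF.matchingOf_empty] at h2
  rw [secondOrderExpansion_eq, h2]
  simp only [diff1_eq_lowerDiff, hF.diff2_eq_lowerDiff₂]

end MetaRotations

end StableMatchings

namespace StableMatchings

/-! ### Infinite sums of nonnegative extended reals. -/

section ExtendedReals

theorem ereal_coe_sum {ι : Type*} (s : Finset ι) (g : ι → ℝ) :
    ((∑ i ∈ s, g i : ℝ) : EReal) = ∑ i ∈ s, (g i : EReal) := by
  classical
  induction s using Finset.induction_on with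
  | empty => simp
  | insert i s hi ih => rw [Finset.sum_insert hi, Finset.sum_insert hi, EReal.coe_add, ih]

theorem ereal_add_eq_top_iff {x y : EReal} (hx : 0 ≤ x) (hy : 0 ≤ y) :
    x + y = ⊤ ↔ x = ⊤ ∨ y = ⊤ := by
  have h := EReal.add_ne_top_iff_ne_top₂ (x := x) (y := y)
    (ne_of_gt (lt_of_lt_of_le EReal.bot_lt_zero hx))
    (ne_of_gt (lt_of_lt_of_le EReal.bot_lt_zero hy))
  tauto

theorem ereal_sum_eq_top_iff {ι : Type*} (s : Finset ι) {g : ι → EReal} (h : ∀ i, 0 ≤ g i) :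
    ∑ i ∈ s, g i = ⊤ ↔ ∃ i ∈ s, g i = ⊤ := by
  classical
  induction s using Finset.induction_on with
  | empty => simp
  | insert i s hi ih =>
    rw [Finset.sum_insert hi, ereal_add_eq_top_iff (h i) (Finset.sum_nonneg fun i _ => h i), ih]
    simp

theorem ite_eq_top_iff {p : Prop} [Decidable p] {x : EReal} :
    (if p then x else 0) = ⊤ ↔ p ∧ x = ⊤ := by
  by_cases h : p <;> simp [h]

theorem ite_nonneg_of {p : Prop} [Decidable p] {x : EReal} (h : p → 0 ≤ x) :
    0 ≤ (if p then x else 0) := by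
  by_cases hp : p <;> simp [hp, h]

end ExtendedReals

/-! ### Cut functions and the necessity of the three conditions. -/

section Cuts

variable {A : Type*} {B : Type*} [Fintype A] [Fintype B] {I : SchoolInstance A B}

theorem source_mem_cutSide (R : Set (Rotation I)) : Vertex.source ∈ cutSide R := Or.inl rfl

theorem sink_notMem_cutSide (R : Set (Rotation I)) : Vertex.sink ∉ cutSide R := by
  simp [cutSide]

theorem rot_mem_cutSide {R : Set (Rotation I)} {ρ : Rotation I} :
    Vertex.rot ρ ∈ cutSide R ↔ ρ ∈ R := by
  simp [cutSide]

open Classical in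
/-- The capacity of the cut `S` in a digraph with real capacities. -/
noncomputable def realCut (d : Vertex I → Vertex I → ℝ) (S : Set (Vertex I)) : ℝ :=
  ∑ x : Vertex I, ∑ y : Vertex I, if x ∈ S ∧ y ∉ S then d x y else 0

theorem realCut_add (d e : Vertex I → Vertex I → ℝ) (S : Set (Vertex I)) :
    realCut (fun x y => d x y + e x y) S = realCut d S + realCut e S := by
  unfold realCut
  rw [← Finset.sum_add_distrib]
  refine Finset.sum_congr rfl fun x _ => ?_
  rw [← Finset.sum_add_distrib]
  refine Finset.sum_congr rfl fun y _ => ?_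
  split_ifs <;> simp

open Classical in
/-- The capacity of a cut in a digraph that is given by a family of arcs. -/
theorem realCut_arcs {ι : Type*} [Fintype ι] (u v : ι → Vertex I) (c : ι → ℝ)
    (S : Set (Vertex I)) :
    realCut (fun x y => ∑ i, if x = u i ∧ y = v i then c i else 0) S =
      ∑ i, if u i ∈ S ∧ v i ∉ S then c i else 0 := by
  unfold realCut
  have h : ∀ x y : Vertex I, (if x ∈ S ∧ y ∉ S then
      ∑ i, if x = u i ∧ y = v i then c i else 0 else 0) =
      ∑ i, if x = u i then (if y = v i then (if u i ∈ S ∧ v i ∉ S then c i else 0) else 0)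
        else 0 := by
    intro x y
    by_cases hS : x ∈ S ∧ y ∉ S
    · rw [if_pos hS]
      refine Finset.sum_congr rfl fun i _ => ?_
      by_cases hx : x = u i
      · by_cases hy : y = v i
        · subst hx hy
          simp [hS]
        · simp [hy]
      · simp [hx]
    · rw [if_neg hS]
      refine (Finset.sum_eq_zero fun i _ => ?_).symm
      by_cases hx : x = u i
      · by_cases hy : y = v i
        · subst hx hy
          simp only [hS, if_false, ite_self]
        · simp [hy]
      · simp [hx]
  simp only [h]
  simp_rw [Finset.sum_comm (t := (Finset.univ : Finset ι))]
  simp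

open Classical in
/-- The total capacity of the arcs between `X` and `Y`. -/
noncomputable def capacityBetween (d : Vertex I → Vertex I → ℝ) (X Y : Set (Vertex I)) : ℝ :=
  ∑ x : Vertex I, ∑ y : Vertex I, if (x ∈ X ∧ y ∈ Y) ∨ (x ∈ Y ∧ y ∈ X) then d x y else 0

theorem capacityBetween_nonneg {d : Vertex I → Vertex I → ℝ} (hd : ∀ x y, 0 ≤ d x y)
    (X Y : Set (Vertex I)) : 0 ≤ capacityBetween d X Y :=
  Finset.sum_nonneg fun x _ => Finset.sum_nonneg fun y _ => by
    split_ifs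
    · exact hd x y
    · exact le_rfl

/-- Each arc is sorted by which of `S`, `X`, `Y` and the remaining vertices contain its ends. Its
contributions cancel unless it joins `X` and `Y`, in either direction, and then it counts once. -/
theorem realCut_mixedDiff (d : Vertex I → Vertex I → ℝ) {S X Y : Set (Vertex I)}
    (hX : Disjoint S X) (hY : Disjoint S Y) (hXY : Disjoint X Y) :
    realCut d (S ∪ X) + realCut d (S ∪ Y) - realCut d S - realCut d (S ∪ Y ∪ X) =
      capacityBetween d X Y := by
  classical
  have h : ∀ z, (z ∈ S ∧ z ∉ X ∧ z ∉ Y) ∨ (z ∉ S ∧ z ∈ X ∧ z ∉ Y) ∨ (z ∉ S ∧ z ∉ X ∧ z ∈ Y) ∨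
      (z ∉ S ∧ z ∉ X ∧ z ∉ Y) := by
    intro z
    have h1 : z ∈ S → z ∉ X := fun h => Set.disjoint_left.1 hX h
    have h2 : z ∈ S → z ∉ Y := fun h => Set.disjoint_left.1 hY h
    have h3 : z ∈ X → z ∉ Y := fun h => Set.disjoint_left.1 hXY h
    tauto
  unfold realCut capacityBetween
  simp only [← Finset.sum_add_distrib, ← Finset.sum_sub_distrib]
  refine Finset.sum_congr rfl fun x _ => Finset.sum_congr rfl fun y _ => ?_
  rcases h x with ⟨h1, h2, h3⟩ | ⟨h1, h2, h3⟩ | ⟨h1, h2, h3⟩ | ⟨h1, h2, h3⟩ <;>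
  rcases h y with ⟨h4, h5, h6⟩ | ⟨h4, h5, h6⟩ | ⟨h4, h5, h6⟩ | ⟨h4, h5, h6⟩ <;>
  simp [h1, h2, h3, h4, h5, h6]

theorem cutCapacity_lt_top_iff {D : CapDigraph I} (hD : ∀ x y, 0 ≤ D x y)
    (R : Set (Rotation I)) :
    cutCapacity D R < ⊤ ↔ ∀ x ∈ cutSide R, ∀ y ∉ cutSide R, D x y ≠ ⊤ := by
  classical
  have h : ∀ x y, 0 ≤ if x ∈ cutSide R ∧ y ∉ cutSide R then D x y else 0 :=
    fun x y => ite_nonneg_of fun _ => hD x y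
  rw [lt_top_iff_ne_top, Ne, cutCapacity,
    ereal_sum_eq_top_iff _ fun x => Finset.sum_nonneg fun y _ => h x y]
  simp only [Finset.mem_univ, true_and, ereal_sum_eq_top_iff _ (h _), ite_eq_top_iff]
  grind

theorem cutCapacity_eq_realCut {D : CapDigraph I} {d : Vertex I → Vertex I → ℝ}
    {R : Set (Rotation I)}
    (h : ∀ x ∈ cutSide R, ∀ y ∉ cutSide R, D x y = (d x y : EReal)) :
    cutCapacity D R = (realCut d (cutSide R) : EReal) := by
  classical
  unfold cutCapacity realCut
  rw [ereal_coe_sum]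
  refine Finset.sum_congr rfl fun x _ => ?_
  rw [ereal_coe_sum]
  refine Finset.sum_congr rfl fun y _ => ?_
  by_cases hxy : x ∈ cutSide R ∧ y ∉ cutSide R
  · rw [if_pos hxy, if_pos hxy, h x hxy.1 y hxy.2]
  · rw [if_neg hxy, if_neg hxy, EReal.coe_zero]

theorem cutSide_union (R R' : Set (Rotation I)) :
    cutSide (R ∪ R') = cutSide R ∪ Vertex.rot '' R' := by
  simp only [cutSide, Set.image_union, Set.union_assoc]

variable {F : Set (StableMatching I)} {f : F → ℝ} {D : CapDigraph I}

theorem IsWitness.lt_top_of_mem (hD : IsWitness f D) (M : F) :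
    cutCapacity D (rotationSet M.1) < ⊤ := by
  obtain ⟨-, C, h, -⟩ := hD
  exact (h _).2 ⟨upperClosed_rotationSet M.1, M, rfl⟩

/-- An arc that leaves the intersection or the union of two cut sides leaves one of the two sides,
so it is not infinite when both cuts are finite. -/
theorem IsWitness.isStableSublattice (hD : IsWitness f D) : IsStableSublattice F := by
  intro M hM N hN
  have h1 := hD.lt_top_of_mem ⟨M, hM⟩
  have h2 := hD.lt_top_of_mem ⟨N, hN⟩
  obtain ⟨h0, C, h, -⟩ := hD
  rw [cutCapacity_lt_top_iff h0] at h1 h2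
  constructor
  · have h3 : cutCapacity D (rotationSet M ∩ rotationSet N) < ⊤ := by
      rw [cutCapacity_lt_top_iff h0]
      intro x hx y hy
      simp only [cutSide, Set.image_inter (fun _ _ => Vertex.rot.inj), Set.union_inter_distrib_left,
        Set.mem_inter_iff] at hx hy
      rw [not_and_or] at hy
      exact hy.elim (h1 x hx.1 y) (h2 x hx.2 y)
    obtain ⟨-, J, hJ⟩ := (h _).1 h3
    exact ⟨J.1, J.2, isLUB_iff_rotationSet.2 hJ⟩
  · have h3 : cutCapacity D (rotationSet M ∪ rotationSet N) < ⊤ := by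
      rw [cutCapacity_lt_top_iff h0]
      intro x hx y hy
      have key : cutSide (rotationSet M ∪ rotationSet N) =
          cutSide (rotationSet M) ∪ cutSide (rotationSet N) := by
        rw [cutSide, Set.image_union, Set.union_union_distrib_left]
        rfl
      rw [key] at hx hy
      rw [Set.mem_union, not_or] at hy
      exact hx.elim (fun hx => h1 x hx y hy.1) (fun hx => h2 x hx y hy.2)
    obtain ⟨-, K, hK⟩ := (h _).1 h3
    exact ⟨K.1, K.2, isGLB_iff_rotationSet.2 hK⟩

theorem IsWitness.exists_hasMixedDiff [Nonempty F] (hD : IsWitness f D) :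
    ∃ w : ProperMetaRotation F → ProperMetaRotation F → ℝ, (∀ θ θ', 0 ≤ w θ θ') ∧
      HasMixedDiff (fun Θ => f (matchingOf Θ)) w := by
  have hF := hD.isStableSublattice
  have hfin := hD.lt_top_of_mem
  obtain ⟨h0, C, -, hC⟩ := hD
  -- Passing to `toReal` replaces infinite capacities by `0`, which is harmless because no infinite
  -- arc leaves these cuts.
  have key : ∀ Θ : Set (ProperMetaRotation F), IsLowerSet Θ →
      f (matchingOf Θ) = realCut (fun x y => (D x y).toReal) (cutSide (rotationsOf Θ)) - C := by
    intro Θ hΘ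
    have h1 := rotationSet_eq_rotationsOf_iff.2 (hF.metaSet_matchingOf hΘ)
    have h2 := hfin (matchingOf Θ)
    rw [h1] at h2
    have h3 := hC _ h2 _ h1
    rw [cutCapacity_eq_realCut (d := fun x y => (D x y).toReal) fun x hx y hy =>
      (EReal.coe_toReal ((cutCapacity_lt_top_iff h0 _).1 h2 x hx y hy)
        (ne_of_gt (lt_of_lt_of_le EReal.bot_lt_zero (h0 x y)))).symm, EReal.coe_eq_coe_iff] at h3
    linarith
  -- Adding a meta-rotation adds its block of vertices to the cut side. Distinct blocks are
  -- disjoint, so the weights are the capacities between blocks.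
  refine ⟨fun θ θ' => capacityBetween (fun x y => (D x y).toReal) (Vertex.rot '' θ.carrier)
    (Vertex.rot '' θ'.carrier), fun θ θ' => capacityBetween_nonneg
      (fun x y => EReal.toReal_nonneg (h0 x y)) _ _, ?_⟩
  intro T θ θ' hT hθ hθ' hne h1 h2
  have h3 : IsLowerSet (insert θ (insert θ' T)) := by
    have := h1.union h2
    rwa [Set.insert_union, Set.union_insert, Set.union_eq_self_of_subset_right subset_rfl] at this
  have hdis : ∀ θ, θ ∉ T → Disjoint (cutSide (rotationsOf T)) (Vertex.rot '' θ.carrier) := by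
    intro θ hθ
    rw [Set.disjoint_left]
    rintro _ h ⟨ρ, hρ, rfl⟩
    exact Set.disjoint_left.1 (disjoint_rotationsOf hθ) (rot_mem_cutSide.1 h) hρ
  have h4 := realCut_mixedDiff (fun x y => (D x y).toReal) (hdis θ hθ) (hdis θ' hθ') (by
    refine Set.disjoint_image_of_injective (fun _ _ => Vertex.rot.inj)
      (Set.disjoint_left.2 fun ρ h h' => hne ?_)
    exact ProperMetaRotation.toMetaRotation_injective (MetaRotation.eq_of_mem h h'))
  beta_reduce
  rw [← h4, key _ hT, key _ h1, key _ h2, key _ h3]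
  simp only [rotationsOf_insert, cutSide_union]
  ring

/-! ### The cut digraph: its infinite arcs, its finite arcs, and the witness property. -/

section CutDigraph

variable [Nonempty F] {rep : MetaRotation F → Rotation I} {γ : ℝ}

section

variable (hf : ∀ θ θ' : ProperMetaRotation F, θ ≠ θ' → 0 ≤ diff2 f θ θ')
include hf

omit hf in
theorem infinite_add_nonneg {p : Prop} [Decidable p] {r : ℝ} (hr : 0 ≤ r) :
    0 ≤ (if p then ⊤ else 0) + (r : EReal) :=
  add_nonneg (ite_nonneg_of fun _ => le_top) (EReal.coe_nonneg.2 hr)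

theorem cutDigraph_nonneg (hγ : IsAdmissible f γ) (x y : Vertex I) :
    0 ≤ cutDigraph f rep γ x y := by
  classical
  rcases x with _ | _ | ρ <;> rcases y with _ | _ | ρ' <;> simp only [cutDigraph, le_refl]
  · exact add_nonneg (ite_nonneg_of fun _ => le_top)
      (Finset.sum_nonneg fun θ _ => ite_nonneg_of fun _ => EReal.coe_nonneg.2 hγ.1)
  · exact add_nonneg (ite_nonneg_of fun _ => le_top)
      (Finset.sum_nonneg fun θ _ => ite_nonneg_of fun _ => EReal.coe_nonneg.2 (hγ.2 θ))
  · refine add_nonneg (ite_nonneg_of fun _ => le_top)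
      (Finset.sum_nonneg fun θ _ => Finset.sum_nonneg fun θ' _ => ite_nonneg_of fun h => ?_)
    exact infinite_add_nonneg (mul_nonneg (by norm_num) (hf _ _ h.1))

theorem cutDigraph_rot_rot_eq_top_iff {ρ ρ' : Rotation I} :
    cutDigraph f rep γ (.rot ρ) (.rot ρ') = ⊤ ↔
      (ρ ≠ ρ' ∧ ∃ θ : MetaRotation F, ρ ∈ θ.carrier ∧ ρ' ∈ θ.carrier) ∨
      ∃ θ θ' : ProperMetaRotation F, θ ≠ θ' ∧ ρ = rep θ.toMetaRotation ∧
        ρ' = rep θ'.toMetaRotation ∧ θ'.Above θ := by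
  classical
  have h1 : ∀ θ θ' : ProperMetaRotation F,
      0 ≤ if θ ≠ θ' ∧ ρ = rep θ.toMetaRotation ∧ ρ' = rep θ'.toMetaRotation then
          (if θ'.Above θ then ⊤ else 0) + (((1 / 2) * diff2 f θ θ' : ℝ) : EReal)
        else 0 := fun θ θ' => ite_nonneg_of fun h =>
    infinite_add_nonneg (mul_nonneg (by norm_num) (hf _ _ h.1))
  rw [cutDigraph, ereal_add_eq_top_iff (ite_nonneg_of fun _ => le_top)
    (Finset.sum_nonneg fun θ _ => Finset.sum_nonneg fun θ' _ => h1 θ θ'),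
    ereal_sum_eq_top_iff _ fun θ => Finset.sum_nonneg fun θ' _ => h1 θ θ']
  simp only [ereal_sum_eq_top_iff _ (h1 _), ite_eq_top_iff, Finset.mem_univ, true_and, and_true]
  refine or_congr Iff.rfl (exists_congr fun θ => exists_congr fun θ' => ?_)
  constructor
  · rintro ⟨⟨h2, h3, h4⟩, h⟩
    refine ⟨h2, h3, h4, ?_⟩
    rw [ereal_add_eq_top_iff (ite_nonneg_of fun _ => le_top)
      (EReal.coe_nonneg.2 (mul_nonneg (by norm_num) (hf _ _ h2)))] at h
    exact (ite_eq_top_iff.1 (h.resolve_right (EReal.coe_ne_top _))).1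
  · rintro ⟨h2, h3, h4, h5⟩
    exact ⟨⟨h2, h3, h4⟩, by rw [if_pos h5, EReal.top_add_coe]⟩

end

theorem cutDigraph_source_rot_eq_top_iff (hγ : IsAdmissible f γ) {ρ : Rotation I} :
    cutDigraph f rep γ .source (.rot ρ) = ⊤ ↔
      ∃ θ : MetaRotation F, θ.carrier = initialMeta F ∧ ρ = rep θ := by
  classical
  have h1 : ∀ θ : ProperMetaRotation F,
      0 ≤ if ρ = rep θ.toMetaRotation then (γ : EReal) else 0 := fun θ =>
    ite_nonneg_of fun _ => EReal.coe_nonneg.2 hγ.1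
  rw [cutDigraph, ereal_add_eq_top_iff (ite_nonneg_of fun _ => le_top)
    (Finset.sum_nonneg fun θ _ => h1 θ), ereal_sum_eq_top_iff _ h1]
  simp [ite_eq_top_iff]

theorem cutDigraph_rot_sink_eq_top_iff (hγ : IsAdmissible f γ) {ρ : Rotation I} :
    cutDigraph f rep γ (.rot ρ) .sink = ⊤ ↔
      ∃ θ : MetaRotation F, θ.carrier = finalMeta F ∧ ρ = rep θ := by
  classical
  have h1 : ∀ θ : ProperMetaRotation F,
      0 ≤ if ρ = rep θ.toMetaRotation then (sinkCapacity f γ θ : EReal) else 0 := fun θ =>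
    ite_nonneg_of fun _ => EReal.coe_nonneg.2 (hγ.2 θ)
  rw [cutDigraph, ereal_add_eq_top_iff (ite_nonneg_of fun _ => le_top)
    (Finset.sum_nonneg fun θ _ => h1 θ), ereal_sum_eq_top_iff _ h1]
  simp [ite_eq_top_iff]

open Classical in
/-- The finite capacities of the cut digraph. -/
noncomputable def finiteCapacity (f : F → ℝ) (rep : MetaRotation F → Rotation I) (γ : ℝ)
    (x y : Vertex I) : ℝ :=
  (∑ p : ProperMetaRotation F × ProperMetaRotation F,
    if x = .rot (rep p.1.toMetaRotation) ∧ y = .rot (rep p.2.toMetaRotation) then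
      (if p.1 ≠ p.2 then (1 / 2) * diff2 f p.1 p.2 else 0) else 0) +
  ((∑ θ : ProperMetaRotation F,
    if x = .source ∧ y = .rot (rep θ.toMetaRotation) then γ else 0) +
  ∑ θ : ProperMetaRotation F,
    if x = .rot (rep θ.toMetaRotation) ∧ y = .sink then sinkCapacity f γ θ else 0)

theorem cutDigraph_eq_finiteCapacity
    (hf : ∀ θ θ' : ProperMetaRotation F, θ ≠ θ' → 0 ≤ diff2 f θ θ') (hγ : IsAdmissible f γ)
    {x y : Vertex I} (h : cutDigraph f rep γ x y ≠ ⊤) :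
    cutDigraph f rep γ x y = (finiteCapacity f rep γ x y : EReal) := by
  classical
  rcases x with _ | _ | ρ <;> rcases y with _ | _ | ρ'
  · simp [cutDigraph, finiteCapacity]
  · simp [cutDigraph, finiteCapacity]
  · rw [Ne, cutDigraph_source_rot_eq_top_iff hγ] at h
    rw [cutDigraph, if_neg h, zero_add]
    simp only [finiteCapacity, reduceCtorEq, false_and, if_false, Finset.sum_const_zero, zero_add,
      add_zero, true_and, and_false, Vertex.rot.injEq]
    rw [ereal_coe_sum]
    exact Finset.sum_congr rfl fun θ _ => by split_ifs <;> simp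
  · simp [cutDigraph, finiteCapacity]
  · simp [cutDigraph, finiteCapacity]
  · simp [cutDigraph, finiteCapacity]
  · simp [cutDigraph, finiteCapacity]
  · rw [Ne, cutDigraph_rot_sink_eq_top_iff hγ] at h
    rw [cutDigraph, if_neg h, zero_add]
    simp only [finiteCapacity, reduceCtorEq, if_false, Finset.sum_const_zero, zero_add,
      and_true, and_false, Vertex.rot.injEq]
    rw [ereal_coe_sum]
    exact Finset.sum_congr rfl fun θ _ => by split_ifs <;> simp
  · rw [Ne, cutDigraph_rot_rot_eq_top_iff hf, not_or] at h
    rw [cutDigraph, if_neg h.1, zero_add]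
    simp only [finiteCapacity, reduceCtorEq, false_and, if_false, Finset.sum_const_zero,
      add_zero, and_false, Vertex.rot.injEq]
    rw [Fintype.sum_prod_type, ereal_coe_sum]
    refine Finset.sum_congr rfl fun θ _ => ?_
    rw [ereal_coe_sum]
    refine Finset.sum_congr rfl fun θ' _ => ?_
    by_cases h1 : θ ≠ θ' ∧ ρ = rep θ.toMetaRotation ∧ ρ' = rep θ'.toMetaRotation
    · have h2 : ¬ θ'.Above θ := fun h2 => h.2 ⟨θ, θ', h1.1, h1.2.1, h1.2.2, h2⟩
      rw [if_pos h1, if_neg h2, if_pos h1.2, if_pos h1.1, zero_add]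
    · rw [if_neg h1]
      split_ifs with h2 h3
      · exact absurd ⟨h3, h2⟩ h1
      · simp
      · simp

variable (hrep : ∀ θ, rep θ ∈ θ.carrier)
include hrep

theorem rep_mem_rotationSet_iff (M : F) (θ : ProperMetaRotation F) :
    rep θ.toMetaRotation ∈ rotationSet M.1 ↔ θ ∈ metaSet M :=
  (mem_metaSet_iff (hrep θ.toMetaRotation)).symm

/-- The infinite arcs keep each class together, force the initial class in and the final class out,
and make the chosen proper classes a lower set. These are exactly the rotation sets of members of
`F`, so upper-closedness in the rotation poset needs no arcs of its own. -/
theorem cutCapacity_cutDigraph_lt_top_iff (hF : IsStableSublattice F)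
    (hf : ∀ θ θ' : ProperMetaRotation F, θ ≠ θ' → 0 ≤ diff2 f θ θ') (hγ : IsAdmissible f γ)
    (R : Set (Rotation I)) :
    cutCapacity (cutDigraph f rep γ) R < ⊤ ↔ ∃ M : F, rotationSet M.1 = R := by
  rw [cutCapacity_lt_top_iff (cutDigraph_nonneg hf hγ)]
  constructor
  · intro h
    have hclass : ∀ (θ : MetaRotation F) (ρ ρ' : Rotation I), ρ ∈ θ.carrier → ρ' ∈ θ.carrier →
        ρ ∈ R → ρ' ∈ R := by
      intro θ ρ ρ' h1 h2 hρ
      by_contra hρ'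
      refine h _ (rot_mem_cutSide.2 hρ) _ (mt rot_mem_cutSide.1 hρ')
        ((cutDigraph_rot_rot_eq_top_iff hf).2 (Or.inl ⟨?_, θ, h1, h2⟩))
      rintro rfl
      exact hρ' hρ
    have hinit : initialMeta F ⊆ R := by
      intro ρ hρ
      refine hclass (metaOf F ρ) _ ρ (hrep _) (mem_metaOf ρ) ?_
      by_contra hρ'
      exact h _ (source_mem_cutSide R) _ (mt rot_mem_cutSide.1 hρ')
        ((cutDigraph_source_rot_eq_top_iff hγ).2 ⟨_, metaOf_carrier_of_mem_initial hρ, rfl⟩)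
    have hfinal : ∀ ρ ∈ finalMeta F, ρ ∉ R := by
      intro ρ hρ hρR
      exact h _ (rot_mem_cutSide.2 (hclass (metaOf F ρ) _ _ (mem_metaOf ρ) (hrep _) hρR)) _
        (sink_notMem_cutSide R)
        ((cutDigraph_rot_sink_eq_top_iff hγ).2 ⟨_, metaOf_carrier_of_mem_final hρ, rfl⟩)
    have hΘ : IsLowerSet {θ : ProperMetaRotation F | rep θ.toMetaRotation ∈ R} := by
      intro θ θ' hle hθ
      rcases hle.eq_or_lt with rfl | hlt
      · exact hθ
      by_contra hθ'
      exact h _ (rot_mem_cutSide.2 hθ) _ (mt rot_mem_cutSide.1 hθ')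
        ((cutDigraph_rot_rot_eq_top_iff hf).2 (Or.inr ⟨θ, θ', hlt.ne', rfl, rfl, hle⟩))
    refine ⟨matchingOf _, (rotationSet_eq_rotationsOf_iff.2 (hF.metaSet_matchingOf hΘ)).trans ?_⟩
    ext ρ
    by_cases h0 : ρ ∈ initialMeta F
    · exact iff_of_true (Or.inl h0) (hinit h0)
    by_cases hz : ρ ∈ finalMeta F
    · refine iff_of_false ?_ (hfinal ρ hz)
      rw [← rotationSet_eq_rotationsOf_iff.2 (hF.metaSet_matchingOf hΘ)]
      exact hz _ (Subtype.property _)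
    obtain ⟨θ, hθ⟩ := exists_proper_of_notMem h0 hz
    rw [mem_rotationsOf_iff hθ]
    exact ⟨hclass _ _ _ (hrep _) hθ, hclass _ _ _ hθ (hrep _)⟩
  · rintro ⟨M, rfl⟩ x hx y hy htop
    rcases x with _ | _ | ρ
    · rcases y with _ | _ | ρ'
      · exact hy (source_mem_cutSide _)
      · simp [cutDigraph] at htop
      · rw [cutDigraph_source_rot_eq_top_iff hγ] at htop
        obtain ⟨θ, hθ, rfl⟩ := htop
        have h1 : rep θ ∈ initialMeta F := hθ ▸ hrep θ
        exact hy (rot_mem_cutSide.2 (h1 M.1 M.2))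
    · exact sink_notMem_cutSide _ hx
    · rw [rot_mem_cutSide] at hx
      rcases y with _ | _ | ρ'
      · exact hy (source_mem_cutSide _)
      · rw [cutDigraph_rot_sink_eq_top_iff hγ] at htop
        obtain ⟨θ, hθ, rfl⟩ := htop
        have h1 : rep θ ∈ finalMeta F := hθ ▸ hrep θ
        exact h1 M.1 M.2 hx
      · rw [rot_mem_cutSide] at hy
        rw [cutDigraph_rot_rot_eq_top_iff hf] at htop
        rcases htop with ⟨-, θ, h1, h2⟩ | ⟨θ, θ', -, rfl, rfl, hle⟩
        · rw [← θ.subset_iff h1 M.2, θ.subset_iff h2 M.2] at hx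
          exact hy hx
        · rw [rep_mem_rotationSet_iff hrep] at hx hy
          exact hy (isLowerSet_metaSet M hle hx)

/-- Each proper meta-rotation pays `γ` once, on the source arc if it is outside `metaSet M` and
within the sink arc otherwise; this yields the constant. -/
theorem realCut_finiteCapacity (M : F) :
    realCut (finiteCapacity f rep γ) (cutSide (rotationSet M.1)) =
      secondOrderExpansion f M +
        (γ * Fintype.card (ProperMetaRotation F) - f (largest F)) := by
  classical
  unfold finiteCapacity
  rw [realCut_add, realCut_add, realCut_arcs, realCut_arcs (fun _ => Vertex.source),
    realCut_arcs _ (fun _ => Vertex.sink), Fintype.sum_prod_type]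
  simp only [rot_mem_cutSide, rep_mem_rotationSet_iff hrep, source_mem_cutSide,
    sink_notMem_cutSide, true_and, not_false_eq_true, and_true]
  have hcard : γ * Fintype.card (ProperMetaRotation F) = ∑ _θ : ProperMetaRotation F, γ := by
    simp [mul_comm]
  rw [secondOrderExpansion, hcard, Finset.mul_sum]
  have h : ∀ θ : ProperMetaRotation F,
      (∑ θ' : ProperMetaRotation F, if θ ∈ metaSet M ∧ θ' ∉ metaSet M then
        (if θ ≠ θ' then (1 / 2) * diff2 f θ θ' else 0) else 0) +
      ((if θ ∉ metaSet M then γ else 0) + if θ ∈ metaSet M then sinkCapacity f γ θ else 0) =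
      (if θ ∈ metaSet M then diff1 f θ else 0) -
      (1 / 2) * (∑ θ' : ProperMetaRotation F,
        if θ ∈ metaSet M ∧ θ' ∈ metaSet M ∧ θ ≠ θ' then diff2 f θ θ' else 0) + γ := by
    intro θ
    by_cases hθ : θ ∈ metaSet M
    · simp only [hθ, true_and, not_true_eq_false, if_false, if_true, sinkCapacity, zero_add]
      -- The sum in the sink capacity is split by membership of `θ'` in `metaSet M`: the outside
      -- part cancels the arcs leaving `θ` in the cut, and the inside part is the second order term.
      have h1 : (∑ θ' : ProperMetaRotation F, if θ' ≠ θ then diff2 f θ θ' else 0) =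
          2 * (∑ θ' : ProperMetaRotation F, if θ' ∉ metaSet M then
            (if θ ≠ θ' then (1 / 2) * diff2 f θ θ' else 0) else 0) +
          ∑ θ' : ProperMetaRotation F, if θ' ∈ metaSet M ∧ θ ≠ θ' then diff2 f θ θ' else 0 := by
        rw [Finset.mul_sum, ← Finset.sum_add_distrib]
        refine Finset.sum_congr rfl fun θ' _ => ?_
        by_cases h2 : θ' ∈ metaSet M <;> by_cases h3 : θ' = θ
        · simp [h3]
        · simp [h2, h3, Ne.symm h3]
        · simp [h3]
        · simp [h2, h3, Ne.symm h3]
      rw [h1]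
      ring
    · simp [hθ]
  have h2 := Finset.sum_congr (rfl : (Finset.univ : Finset (ProperMetaRotation F)) = _)
    fun θ _ => h θ
  simp only [Finset.sum_add_distrib, Finset.sum_sub_distrib] at h2
  linarith

/-- If `F` is a sublattice and `f` is equal to its second order expansion, with nonnegative second
order differentials, then the cut digraph is a witness digraph. -/
theorem isWitness_cutDigraph (hF : IsStableSublattice F)
    (hf : ∀ θ θ' : ProperMetaRotation F, θ ≠ θ' → 0 ≤ diff2 f θ θ')
    (hexp : ∀ M : F, f M = secondOrderExpansion f M) (hγ : IsAdmissible f γ) :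
    IsWitness f (cutDigraph f rep γ) := by
  refine ⟨cutDigraph_nonneg hf hγ,
    γ * Fintype.card (ProperMetaRotation F) - f (largest F), fun R => ?_, ?_⟩
  · rw [cutCapacity_cutDigraph_lt_top_iff hrep hF hf hγ]
    constructor
    · rintro ⟨M, rfl⟩
      exact ⟨upperClosed_rotationSet M.1, M, rfl⟩
    · exact fun h => h.2
  · rintro _ hlt M rfl
    rw [cutCapacity_lt_top_iff (cutDigraph_nonneg hf hγ)] at hlt
    rw [cutCapacity_eq_realCut fun x hx y hy =>
      cutDigraph_eq_finiteCapacity hf hγ (hlt x hx y hy), realCut_finiteCapacity hrep, hexp M]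

end CutDigraph

/-! ### Existence of an admissible constant, and the assembly of both directions. -/

theorem exists_isAdmissible [Nonempty F] (f : F → ℝ) : ∃ γ : ℝ, IsAdmissible f γ := by
  have h0 : ∀ θ, 0 ≤ |sinkCapacity f 0 θ| := fun θ => abs_nonneg _
  -- The sum dominates every single absolute value, and `γ` enters each sink capacity additively.
  refine ⟨∑ θ, |sinkCapacity f 0 θ|, Finset.sum_nonneg fun θ _ => h0 θ, fun θ => ?_⟩
  have h1 := Finset.single_le_sum (fun θ _ => h0 θ) (Finset.mem_univ θ)
  have h2 := neg_abs_le (sinkCapacity f 0 θ)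
  have h3 : ∀ γ, sinkCapacity f γ θ = sinkCapacity f 0 θ + γ := fun γ => by
    simp [sinkCapacity]
  rw [h3]
  linarith

theorem MinCutRepresentable.conditions [Nonempty F] (h : MinCutRepresentable f) :
    IsStableSublattice F ∧ (∀ θ θ' : ProperMetaRotation F, θ ≠ θ' → 0 ≤ diff2 f θ θ') ∧
      ∀ M : F, f M = secondOrderExpansion f M := by
  obtain ⟨D, hD⟩ := h
  have hF := hD.isStableSublattice
  obtain ⟨w, hw, hmix⟩ := hD.exists_hasMixedDiff
  refine ⟨hF, fun θ θ' hne => ?_, fun M => hF.eq_secondOrderExpansion hmix M⟩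
  rw [hF.diff2_eq_lowerDiff₂]
  exact hmix.lowerDiff₂_nonneg hw hne

end Cuts

end StableMatchings

theorem theorem3 {A : Type*} {B : Type*} [Fintype A] [Fintype B]
    (I : StableMatchings.SchoolInstance A B)
    (F : Set (StableMatchings.StableMatching I)) [Nonempty F] (f : F → ℝ) :
    (StableMatchings.MinCutRepresentable f ↔
      StableMatchings.IsStableSublattice F ∧
      (∀ θ θ' : StableMatchings.ProperMetaRotation F, θ ≠ θ' →
        0 ≤ StableMatchings.diff2 f θ θ') ∧
      (∀ M : F, f M = StableMatchings.secondOrderExpansion f M)) ∧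
    (StableMatchings.MinCutRepresentable f →
      ∀ rep : StableMatchings.MetaRotation F → StableMatchings.Rotation I,
        (∀ θ, rep θ ∈ θ.carrier) →
        ∀ γ : ℝ, StableMatchings.IsAdmissible f γ →
          StableMatchings.IsWitness f (StableMatchings.cutDigraph f rep γ)) := by
  refine ⟨⟨fun h => h.conditions, fun ⟨hF, hf, hexp⟩ => ?_⟩, fun h rep hrep γ hγ => ?_⟩
  · obtain ⟨γ, hγ⟩ := StableMatchings.exists_isAdmissible f
    choose rep hrep using fun θ : StableMatchings.MetaRotation F => θ.nonempty
    exact ⟨_, StableMatchings.isWitness_cutDigraph hrep hF hf hexp hγ⟩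
  · obtain ⟨hF, hf, hexp⟩ := h.conditions
    exact StableMatchings.isWitness_cutDigraph hrep hF hf hexp hγ
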